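/- Let $L$ be a first-order language and let $\mathcal R$ be an $L$-structure with universe $\mathbb R$ that expands the ordered additive group $(\mathbb R,<,+)$ and is o-minimal: every subset of $\mathbb R$ definable in $\mathcal R$ with parameters is a finite union of points and open intervals (with endpoints in $\mathbb R\cup\{-\infty,+\infty\}$). Let $T=\mathrm{Th}(\mathcal R)$, let $H$ be a new unary predicate symbol and $L_H=L\cup\{H\}$. Let $T^{\mathrm{indep}}$, the theory of $H$-structures of $T$, be the $L_H$-theory consisting of $T$ together with the following axioms, for all $n,m,k\in\mathbb N$ and all $L$-formulas $\varphi(x_1,\dots,x_n,x)$, $\psi$ in the displayed variables (here $\exists^{<k}x$ means "there are fewer than $k$ elements $x$", and $\exists^\infty x\,\varphi$, "there are infinitely many $x$ with $\varphi$", stands for $\exists^{\ge l}x\,\varphi$ for any $l$ such that $T\models\forall x_1\dots x_n(\exists^{\ge l}x\,\varphi\to\exists^{\ge j}x\,\varphi)$ for all $j$; since $T$ eliminates $\exists^\infty$, such an $l$ exists for every $\varphi$): 1. Independence: $(\forall x_1\in H)\dots(\forall x_n\in H)(\forall x\in H)\big(\bigwedge_{i=1}^n x\neq x_i\wedge\exists^{<k}x\,\psi(x_1,\dots,x_n,x)\to\neg\psi(x_1,\dots,x_n,x)\big)$.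 2. Density: $\forall x_1\dots x_n\big(\exists^\infty x\,\varphi(x_1,\dots,x_n,x)\to(\exists x\in H)\,\varphi(x_1,\dots,x_n,x)\big)$. 3. Extension: $\forall x_1\dots x_n\big(\forall y_1\dots y_m\,\exists^{<k}x\,\psi(x_1,\dots,x_n,y_1,\dots,y_m,x)\wedge\exists^\infty x\,\varphi(x_1,\dots,x_n,x)\to\exists x\,(\varphi(x_1,\dots,x_n,x)\wedge(\forall y_1\in H)\dots(\forall y_m\in H)\,\neg\psi(x_1,\dots,x_n,y_1,\dots,y_m,x))\big)$. Let $(\mathfrak C,\mathfrak H)$ be a monster model of $T^{\mathrm{indep}}$, that is, a saturated model: every $1$-type over a set $A\subseteq\mathfrak C$ with $|A|<|\mathfrak C|$ is realized. Put $$o(\mathfrak H)=\{f(\mathfrak H)\mid f\in\mathrm{Aut}(\mathfrak C)\},\qquad e(\mathfrak H)=\{\mathfrak H'\subseteq\mathfrak C\mid(\mathfrak C,\mathfrak H)\equiv(\mathfrak C,\mathfrak H')\},$$ where $\mathrm{Aut}(\mathfrak C)$ is the group of automorphisms of the $L$-structure $\mathfrak C$ and $\equiv$ is elementary equivalence of $L_H$-structures.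 Then $o(\mathfrak H)\neq e(\mathfrak H)$. -/

import Mathlib

universe u v w

namespace HStr

open FirstOrder FirstOrder.Language
open scoped Cardinal

/-! ### Ordered additive groups and o-minimality -/

/-- The function symbols of the language of ordered additive groups: a binary symbol `+`. -/
inductive OAddFunc : ℕ → Type
  | add : OAddFunc 2

/-- The relation symbols of the language of ordered additive groups: a binary symbol `<`. -/
inductive OAddRel : ℕ → Type
  | lt : OAddRel 2

/-- The language `{<, +}` of ordered additive groups. -/
def oaddLang : FirstOrder.Language.{0, 0} := ⟨OAddFunc, OAddRel⟩

/-- The real numbers as the ordered additive group `(ℝ, <, +)`. -/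
instance realOAddStructure : oaddLang.Structure ℝ where
  funMap := fun f x => match f with
    | OAddFunc.add => x 0 + x 1
  RelMap := fun r x => match r with
    | OAddRel.lt => x 0 < x 1

/-- `s` is a point or an open interval with endpoints in `M ∪ {-∞, +∞}`. -/
def IsPointOrOpenInterval {M : Type w} [LinearOrder M] (s : Set M) : Prop :=
  (∃ a, s = {a}) ∨ (∃ a b, s = Set.Ioo a b) ∨ (∃ a, s = Set.Iio a) ∨ (∃ a, s = Set.Ioi a) ∨
    s = Set.univ

/-- O-minimality: every subset of `M` that is definable with parameters from `M` is a union of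
finitely many points and open intervals. -/
def IsOMinimal (L : FirstOrder.Language.{u, v}) (M : Type w) [L.Structure M] [LinearOrder M] : Prop :=
  ∀ s : Set M, (Set.univ : Set M).Definable₁ L s →
    ∃ F : Set (Set M), F.Finite ∧ (∀ I ∈ F, IsPointOrOpenInterval I) ∧ s = ⋃₀ F

/-! ### Expansions by a unary predicate, orbits and elementary classes -/

/-- The relation symbols of the language with one unary predicate. -/
inductive PredRel : ℕ → Type
  | H : PredRel 1

/-- The language with a single unary predicate symbol `H` and nothing else. -/
def predLang : FirstOrder.Language.{0, 0} := ⟨fun _ => Empty, PredRel⟩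

/-- The language `L ∪ {H}`, where `H` is a new unary predicate symbol. -/
abbrev withH (L : FirstOrder.Language.{u, v}) : FirstOrder.Language.{u, v} := L.sum predLang

/-- The universe of the expansion `(M, D)`, a copy of `M`. -/
def Expand (M : Type w) (_D : Set M) : Type w := M

instance expandBase (L : FirstOrder.Language.{u, v}) (M : Type w) [inst : L.Structure M] (D : Set M) :
    L.Structure (Expand M D) := inst

/-- In `(M, D)` the new predicate is interpreted as `D`. Together with the structure of `M`, this
makes `(M, D)` a structure for `L ∪ {H}`. -/
instance expandPred (M : Type w) (D : Set M) : predLang.Structure (Expand M D) where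
  funMap := fun f _ => nomatch f
  RelMap := fun r x => match r with
    | PredRel.H => (show M from x 0) ∈ D

/-- `o(D)`: the set of all images of `D` under automorphisms of `M`. -/
def orbit (L : FirstOrder.Language.{u, v}) {M : Type w} [L.Structure M] (D : Set M) : Set (Set M) :=
  {D' | ∃ f : M ≃[L] M, f '' D = D'}

/-- `e(D)`: the set of all subsets `D'` of `M` such that `(M, D)` and `(M, D')` are elementarily
equivalent in the language `L ∪ {H}`. -/
def elemClass (L : FirstOrder.Language.{u, v}) {M : Type w} [L.Structure M] (D : Set M) : Set (Set M) :=
  {D' | (withH L).ElementarilyEquivalent (Expand M D) (Expand M D')}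

/-! ### Saturation -/

/-- `M` is saturated: for every `A ⊆ M` of cardinality less than that of `M`, every 1-type over
`A` (a set of formulas in one variable with parameters from `A` that is finitely satisfiable in
`M`) is realized in `M`. -/
def IsSaturated (L : FirstOrder.Language.{u, v}) (M : Type w) [L.Structure M] : Prop :=
  ∀ A : Set M, #A < #M → ∀ p : Set (L[[A]].Formula (Fin 1)),
    (∀ p₀ : Finset (L[[A]].Formula (Fin 1)), (p₀ : Set (L[[A]].Formula (Fin 1))) ⊆ p →
      ∃ a : M, ∀ φ ∈ p₀, φ.Realize (fun _ => a)) →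
    ∃ a : M, ∀ φ ∈ p, φ.Realize (fun _ => a)

/-- `M` is a monster model of the theory `T`: a saturated model of `T`. No condition is imposed on
the cardinality of `M`; in particular, saturated models of strongly inaccessible cardinality are
included. -/
def IsMonsterModel {L : FirstOrder.Language.{u, v}} (T : L.Theory) (M : Type w) [L.Structure M] : Prop :=
  M ⊨ T ∧ IsSaturated L M

/-! ### The theory of H-structures -/

section Indep

variable {L : FirstOrder.Language.{u, v}}

/-- The universal closure `∀ x₁ … xₙ φ`. -/
noncomputable def univClosure {n : ℕ} (φ : L.Formula (Fin n)) : L.Sentence :=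
  Formula.iAlls (Fin n) (φ.relabel (Sum.inr : Fin n → Empty ⊕ Fin n))

/-- The formula `∃^{≥ k} x φ`, where `x` is the variable of `φ` indexed by `Fin 1`: there are
pairwise distinct `y₁, …, y_k` that all satisfy `φ`. -/
noncomputable def existsGE {α : Type} (k : ℕ) (φ : L.Formula (α ⊕ Fin 1)) : L.Formula α :=
  Formula.iExs (Fin k)
    (Formula.iInf (fun i : Fin k => φ.relabel (Sum.map id (fun _ => i))) ⊓
      Formula.iInf (fun ij : {ij : Fin k × Fin k // ij.1 ≠ ij.2} =>
        ∼(Term.equal (Term.var (Sum.inr ij.1.1) : L.Term (α ⊕ Fin k))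
          (Term.var (Sum.inr ij.1.2)))))

/-- The formula `∃^{< k} x φ`. -/
noncomputable def existsLT {α : Type} (k : ℕ) (φ : L.Formula (α ⊕ Fin 1)) : L.Formula α :=
  ∼(existsGE k φ)

/-- Modulo `T`, having at least `k` solutions of `φ` is the same as having infinitely many, so
that `∃^{≥ k} x φ` expresses `∃^∞ x φ`. If `T` eliminates `∃^∞`, every `φ` has such a `k`. -/
def ExpressesInf (T : L.Theory) {α : Type} (k : ℕ) (φ : L.Formula (α ⊕ Fin 1)) : Prop :=
  ∀ m : ℕ, T ⊨ᵇ (existsGE k φ).imp (existsGE m φ)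

/-- The atomic formula `H(x)`. -/
def inH {α : Type} (x : α) : (withH L).Formula α :=
  Relations.formula₁ (Sum.inr PredRel.H : (withH L).Relations 1) (Term.var x)

/-- An `L`-formula, seen as a formula of `L ∪ {H}`. -/
def up {α : Type} (φ : L.Formula α) : (withH L).Formula α :=
  (LHom.sumInl : L →ᴸ withH L).onFormula φ

/-- Independence of `H`:
`(∀ x₁ ∈ H) … (∀ xₙ ∈ H) (∀ x ∈ H) (⋀ᵢ x ≠ xᵢ ∧ ∃^{<k} x ψ(x₁, …, xₙ, x) → ¬ ψ(x₁, …, xₙ, x))`. -/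
noncomputable def independenceAxiom {n : ℕ} (k : ℕ) (ψ : L.Formula (Fin n ⊕ Fin 1)) :
    (withH L).Sentence :=
  univClosure <|
    (Formula.iInf (fun i : Fin n => inH i)).imp <|
      Formula.iAlls (Fin 1) <|
        (inH (Sum.inr 0)).imp <|
          (Formula.iInf (fun i : Fin n =>
              ∼(Term.equal (Term.var (Sum.inr 0) : (withH L).Term (Fin n ⊕ Fin 1))
                (Term.var (Sum.inl i)))) ⊓
            up ((existsLT k ψ).relabel Sum.inl)).imp
          (∼(up ψ))

/-- Density of `H`: `∀ x₁ … xₙ (∃^∞ x φ(x₁, …, xₙ, x) → (∃ x ∈ H) φ(x₁, …, xₙ, x))`, where `∃^∞` is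
expressed as `∃^{≥ l}`. -/
noncomputable def densityAxiom {n : ℕ} (l : ℕ) (φ : L.Formula (Fin n ⊕ Fin 1)) :
    (withH L).Sentence :=
  univClosure <|
    (up (existsGE l φ)).imp <| Formula.iExs (Fin 1) (inH (Sum.inr 0) ⊓ up φ)

/-- Extension:
`∀ x₁ … xₙ (∀ y₁ … yₘ ∃^{<k} x ψ(x₁, …, xₙ, y₁, …, yₘ, x) ∧ ∃^∞ x φ(x₁, …, xₙ, x) →
  ∃ x (φ(x₁, …, xₙ, x) ∧ (∀ y₁ ∈ H) … (∀ yₘ ∈ H) ¬ ψ(x₁, …, xₙ, y₁, …, yₘ, x)))`,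
where `∃^∞` is expressed as `∃^{≥ l}`. -/
noncomputable def extensionAxiom {n m : ℕ} (k l : ℕ) (φ : L.Formula (Fin n ⊕ Fin 1))
    (ψ : L.Formula ((Fin n ⊕ Fin m) ⊕ Fin 1)) : (withH L).Sentence :=
  univClosure <|
    (up (Formula.iAlls (Fin m) (existsLT k ψ)) ⊓ up (existsGE l φ)).imp <|
      Formula.iExs (Fin 1) <|
        up φ ⊓ Formula.iAlls (Fin m)
          ((Formula.iInf (fun j : Fin m => inH (Sum.inr j))).imp
            (∼(up (ψ.relabel
              (Sum.elim (Sum.elim (Sum.inl ∘ Sum.inl) Sum.inr) (Sum.inl ∘ Sum.inr) :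
                (Fin n ⊕ Fin m) ⊕ Fin 1 → (Fin n ⊕ Fin 1) ⊕ Fin m)))))

/-- `T^indep`, the theory of H-structures of `T`: its models are the structures `(M, H)` with
`M ⊨ T` that satisfy all independence, density and extension axioms. -/
def indepTheory (T : L.Theory) : (withH L).Theory :=
  (LHom.sumInl : L →ᴸ withH L).onTheory T ∪
  {σ | ∃ (n k : ℕ) (ψ : L.Formula (Fin n ⊕ Fin 1)), σ = independenceAxiom k ψ} ∪
  {σ | ∃ (n l : ℕ) (φ : L.Formula (Fin n ⊕ Fin 1)),
    ExpressesInf T l φ ∧ σ = densityAxiom l φ} ∪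
  {σ | ∃ (n m k l : ℕ) (φ : L.Formula (Fin n ⊕ Fin 1)) (ψ : L.Formula ((Fin n ⊕ Fin m) ⊕ Fin 1)),
    ExpressesInf T l φ ∧ σ = extensionAxiom k l φ ψ}

end Indep

end HStr

-- The two sets are separated by a basis. Let `B` be a maximal independent set containing the
-- predicate `H` of the monster model, independence being taken with respect to algebraic closure in
-- the language `L`. Then `acl L B` is everything. An automorphism taking `H` to `B` would make `acl
-- L H` everything too; but the extension axioms make "not algebraic over `H`" a finitely
-- satisfiable type over the empty set, so saturation realizes it. Hence `B` is not in the orbit of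
-- `H`. It remains to see that `B` has the same `L ∪ {H}`-theory as `H`.
--
-- First, `B` is itself the predicate of an H-structure (`AclIndependent.isHSet`). Independence
-- holds by construction, and density is inherited from `H ⊆ B`. For extension, each given parameter
-- is algebraic over finitely many elements of `B`. A sum of sufficiently many distinct elements of
-- `B` depends on every summand, so it is not algebraic over those finitely many elements together
-- with a bounded number of further ones. Density lets such a sum be chosen inside any infinite
-- definable set (`exists_mem_sol_large_support`). This is where the group operation enters.
--
-- Second, the theory of H-structures is complete (`elementarilyEquivalent_of_models`), by a
-- back-and-forth between tuples that are independent from `H` over their entries in `H`. New points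
-- are found in elementary extensions, built as ultrapowers.
--
-- Both steps use two facts about the real structure: `∃^∞` is eliminated, and algebraic closure
-- satisfies exchange (`IsGeometric`). They are proved directly on the real line. Infinite definable
-- sets contain intervals, hence are uncountable and contain rationals, so countability arguments
-- give finiteness. First-order transfer then carries both facts to all models.

universe w' k

namespace HStr

open FirstOrder FirstOrder.Language

/-! ### Definable predicates over the reals -/

section Symbols

variable {L : FirstOrder.Language.{u, v}}

/-- The symbol of `L` that interprets addition. -/
def addSym (ι : oaddLang →ᴸ L) : L.Functions 2 := ι.onFunction (n := 2) OAddFunc.add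

/-- The symbol of `L` that interprets the order. -/
def ltSym (ι : oaddLang →ᴸ L) : L.Relations 2 := ι.onRelation (n := 2) OAddRel.lt

variable [L.Structure ℝ] (ι : oaddLang →ᴸ L) [ι.IsExpansionOn ℝ]

theorem funMap_addSym (x y : ℝ) : Structure.funMap (addSym ι) ![x, y] = x + y :=
  ι.map_onFunction (n := 2) OAddFunc.add ![x, y]

theorem relMap_ltSym (x y : ℝ) : Structure.RelMap (ltSym ι) ![x, y] ↔ x < y :=
  iff_of_eq (ι.map_onRelation (n := 2) OAddRel.lt ![x, y])

end Symbols

section RealDefinability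

variable (L : FirstOrder.Language.{u, v}) [L.Structure ℝ] {α β : Type}

/-- Functions on real tuples that are given by terms with real parameters. -/
def RealTerm (F : (α → ℝ) → ℝ) : Prop :=
  ∃ t : L[[(Set.univ : Set ℝ)]].Term α, ∀ v, t.realize v = F v

/-- Predicates on real tuples that are definable with real parameters. -/
def RealDef (P : (α → ℝ) → Prop) : Prop :=
  ∃ φ : L[[(Set.univ : Set ℝ)]].Formula α, ∀ v, φ.Realize v ↔ P v

variable {L}

theorem RealTerm.var (i : α) : RealTerm L (fun v => v i) := ⟨Term.var i, fun _ => rfl⟩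

theorem RealTerm.const (c : ℝ) : RealTerm L (fun _ : α → ℝ => c) :=
  ⟨(L.con (⟨c, trivial⟩ : (Set.univ : Set ℝ))).term, fun v => by simp⟩

theorem RealTerm.add (ι : oaddLang →ᴸ L) [ι.IsExpansionOn ℝ] {F G : (α → ℝ) → ℝ}
    (hF : RealTerm L F) (hG : RealTerm L G) : RealTerm L (fun v => F v + G v) := by
  obtain ⟨t, ht⟩ := hF
  obtain ⟨s, hs⟩ := hG
  refine ⟨Functions.apply₂ (L := L[[(Set.univ : Set ℝ)]])
    ((L.lhomWithConstants _).onFunction (addSym ι)) t s, fun v => ?_⟩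
  rw [Term.realize_functions_apply₂, ht, hs, LHom.map_onFunction]
  exact funMap_addSym ι _ _

theorem RealDef.lt (ι : oaddLang →ᴸ L) [ι.IsExpansionOn ℝ] {F G : (α → ℝ) → ℝ}
    (hF : RealTerm L F) (hG : RealTerm L G) : RealDef L (fun v => F v < G v) := by
  obtain ⟨t, ht⟩ := hF
  obtain ⟨s, hs⟩ := hG
  refine ⟨Relations.formula₂ (L := L[[(Set.univ : Set ℝ)]])
    ((L.lhomWithConstants _).onRelation (ltSym ι)) t s, fun v => ?_⟩
  rw [Formula.realize_rel₂, ht, hs, LHom.map_onRelation]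
  exact relMap_ltSym ι _ _

theorem RealDef.eq {F G : (α → ℝ) → ℝ}
    (hF : RealTerm L F) (hG : RealTerm L G) : RealDef L (fun v => F v = G v) := by
  obtain ⟨t, ht⟩ := hF
  obtain ⟨s, hs⟩ := hG
  exact ⟨t.equal s, fun v => by simp [ht, hs]⟩

theorem RealDef.not {P : (α → ℝ) → Prop} (hP : RealDef L P) : RealDef L (fun v => ¬ P v) := by
  obtain ⟨φ, hφ⟩ := hP
  exact ⟨φ.not, fun v => by simp [hφ]⟩

theorem RealDef.and {P Q : (α → ℝ) → Prop} (hP : RealDef L P) (hQ : RealDef L Q) :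
    RealDef L (fun v => P v ∧ Q v) := by
  obtain ⟨φ, hφ⟩ := hP
  obtain ⟨ψ, hψ⟩ := hQ
  exact ⟨φ ⊓ ψ, fun v => by simp [hφ, hψ]⟩

theorem RealDef.or {P Q : (α → ℝ) → Prop} (hP : RealDef L P) (hQ : RealDef L Q) :
    RealDef L (fun v => P v ∨ Q v) := by
  obtain ⟨φ, hφ⟩ := hP
  obtain ⟨ψ, hψ⟩ := hQ
  exact ⟨φ ⊔ ψ, fun v => by simp [hφ, hψ]⟩

theorem RealDef.imp {P Q : (α → ℝ) → Prop} (hP : RealDef L P) (hQ : RealDef L Q) :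
    RealDef L (fun v => P v → Q v) := by
  obtain ⟨φ, hφ⟩ := hP
  obtain ⟨ψ, hψ⟩ := hQ
  exact ⟨φ.imp ψ, fun v => by simp [hφ, hψ]⟩

theorem RealDef.congr {P Q : (α → ℝ) → Prop} (hP : RealDef L P) (h : ∀ v, P v ↔ Q v) :
    RealDef L Q := by
  rwa [show Q = P from funext fun v => propext (h v).symm]

theorem RealDef.ex {Q : (α → ℝ) → ℝ → Prop}
    (h : RealDef L (fun w : α ⊕ Fin 1 → ℝ => Q (fun i => w (Sum.inl i)) (w (Sum.inr 0)))) :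
    RealDef L (fun v => ∃ t, Q v t) := by
  obtain ⟨φ, hφ⟩ := h
  refine ⟨φ.iExs (Fin 1), fun v => ?_⟩
  simp only [Formula.realize_iExs, hφ, Sum.elim_inl, Sum.elim_inr]
  exact ⟨fun ⟨i, hi⟩ => ⟨i 0, hi⟩, fun ⟨t, ht⟩ => ⟨fun _ => t, ht⟩⟩

theorem RealDef.all {Q : (α → ℝ) → ℝ → Prop}
    (h : RealDef L (fun w : α ⊕ Fin 1 → ℝ => Q (fun i => w (Sum.inl i)) (w (Sum.inr 0)))) :
    RealDef L (fun v => ∀ t, Q v t) :=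
  (RealDef.ex (Q := fun v t => ¬ Q v t) h.not).not.congr fun v => by simp

theorem RealDef.subst {P : (α → ℝ) → Prop} (hP : RealDef L P) {F : α → (β → ℝ) → ℝ}
    (hF : ∀ i, RealTerm L (F i)) : RealDef L (fun v => P (fun i => F i v)) := by
  obtain ⟨φ, hφ⟩ := hP
  choose t ht using hF
  refine ⟨φ.subst t, fun v => ?_⟩
  simp only [← hφ, Formula.Realize, BoundedFormula.realize_subst, ht]

/-- Families of definable subsets of the line, indexed by tuples. -/
def RealDef₁ (L : FirstOrder.Language.{u, v}) [L.Structure ℝ] (R : (α → ℝ) → ℝ → Prop) : Prop :=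
  RealDef L (fun w : α ⊕ Fin 1 → ℝ => R (fun i => w (Sum.inl i)) (w (Sum.inr 0)))

/-- Families of definable subsets of the plane, indexed by tuples. -/
def RealDef₂ (L : FirstOrder.Language.{u, v}) [L.Structure ℝ]
    (R : (α → ℝ) → ℝ → ℝ → Prop) : Prop :=
  RealDef L (fun w : (α ⊕ Fin 1) ⊕ Fin 1 → ℝ =>
    R (fun i => w (Sum.inl (Sum.inl i))) (w (Sum.inl (Sum.inr 0))) (w (Sum.inr 0)))

theorem RealDef₁.subst {R : (α → ℝ) → ℝ → Prop} (hR : RealDef₁ L R) {X : α → (β → ℝ) → ℝ}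
    {T : (β → ℝ) → ℝ} (hX : ∀ i, RealTerm L (X i)) (hT : RealTerm L T) :
    RealDef L (fun v => R (fun i => X i v) (T v)) :=
  RealDef.subst hR (F := Sum.elim X (fun _ => T)) (by rintro (i | i); exacts [hX i, hT])

theorem RealDef₂.subst {R : (α → ℝ) → ℝ → ℝ → Prop} (hR : RealDef₂ L R)
    {X : α → (β → ℝ) → ℝ} {T Y : (β → ℝ) → ℝ} (hX : ∀ i, RealTerm L (X i)) (hT : RealTerm L T)
    (hY : RealTerm L Y) : RealDef L (fun v => R (fun i => X i v) (T v) (Y v)) :=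
  RealDef.subst hR (F := Sum.elim (Sum.elim X (fun _ => T)) (fun _ => Y))
    (by rintro ((i | i) | i); exacts [hX i, hT, hY])

theorem RealDef.definable₁ {P : ℝ → Prop} (hP : RealDef L (fun v : Fin 1 → ℝ => P (v 0))) :
    (Set.univ : Set ℝ).Definable₁ L {t | P t} := by
  obtain ⟨φ, hφ⟩ := hP
  exact ⟨φ, by ext v; exact (hφ v).symm⟩

end RealDefinability

/-! ### Uniform finiteness for o-minimal expansions of the reals -/

section OMinimal

variable {L : FirstOrder.Language.{u, v}} [L.Structure ℝ]

theorem IsPointOrOpenInterval.exists_Ioo_subset {s : Set ℝ} (h : IsPointOrOpenInterval s)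
    (hs : s.Infinite) : ∃ a b, a < b ∧ Set.Ioo a b ⊆ s := by
  rcases h with ⟨a, rfl⟩ | ⟨a, b, rfl⟩ | ⟨a, rfl⟩ | ⟨a, rfl⟩ | rfl
  · exact absurd (Set.finite_singleton a) hs
  · exact ⟨a, b, Set.nonempty_Ioo.1 hs.nonempty, subset_rfl⟩
  · exact ⟨a - 1, a, by linarith, fun x hx => hx.2⟩
  · exact ⟨a, a + 1, by linarith, fun x hx => hx.1⟩
  · exact ⟨0, 1, by norm_num, Set.subset_univ _⟩

theorem IsPointOrOpenInterval.finite_frontier {s : Set ℝ} (h : IsPointOrOpenInterval s) :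
    (frontier s).Finite := by
  rcases h with ⟨a, rfl⟩ | ⟨a, b, rfl⟩ | ⟨a, rfl⟩ | ⟨a, rfl⟩ | rfl
  · exact (Set.finite_singleton a).subset isClosed_singleton.frontier_subset
  · rcases lt_or_ge a b with hab | hab
    · rw [frontier_Ioo hab]; exact Set.toFinite _
    · simp [Set.Ioo_eq_empty hab.not_gt]
  · simp
  · simp
  · simp

theorem IsOMinimal.exists_Ioo_subset (h : IsOMinimal L ℝ) {P : ℝ → Prop}
    (hP : RealDef L (fun v : Fin 1 → ℝ => P (v 0))) (hs : {t | P t}.Infinite) :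
    ∃ a b, a < b ∧ ∀ t, a < t → t < b → P t := by
  obtain ⟨F, hF, hI, he⟩ := h _ hP.definable₁
  have : ∃ I ∈ F, I.Infinite := by
    by_contra hc
    push Not at hc
    exact hs (he ▸ hF.sUnion hc)
  obtain ⟨I, hIF, hinf⟩ := this
  obtain ⟨a, b, hab, hsub⟩ := (hI I hIF).exists_Ioo_subset hinf
  refine ⟨a, b, hab, fun t h1 h2 => ?_⟩
  have : t ∈ {t | P t} := he ▸ Set.mem_sUnion_of_mem (hsub ⟨h1, h2⟩) hIF
  exact this

theorem finite_frontier_sUnion {F : Set (Set ℝ)} (hF : F.Finite)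
    (h : ∀ s ∈ F, (frontier s).Finite) : (frontier (⋃₀ F)).Finite := by
  induction F, hF using Set.Finite.induction_on with
  | empty => simp
  | @insert s F _ _ ih =>
    rw [Set.sUnion_insert]
    refine Set.Finite.subset ?_ (frontier_union_subset _ _)
    exact ((h s (Set.mem_insert _ _)).subset Set.inter_subset_left).union
      ((ih fun t ht => h t (Set.mem_insert_of_mem _ ht)).subset Set.inter_subset_right)

theorem IsOMinimal.finite_frontier (h : IsOMinimal L ℝ) {P : ℝ → Prop}
    (hP : RealDef L (fun v : Fin 1 → ℝ => P (v 0))) : (frontier {t | P t}).Finite := by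
  obtain ⟨F, hF, hI, he⟩ := h _ hP.definable₁
  rw [he]
  exact finite_frontier_sUnion hF fun s hs => (hI s hs).finite_frontier

theorem not_countable_Ioo {a b : ℝ} (hab : a < b) : ¬ (Set.Ioo a b).Countable := fun h => by
  have h1 := Cardinal.mk_Ioo_real hab
  have h2 := Cardinal.le_aleph0_iff_set_countable.2 h
  rw [h1] at h2
  exact absurd h2 Cardinal.aleph0_lt_continuum.not_ge

/-- An infinite definable set contains an interval, which is uncountable. This turns countability
obtained by topological means into finiteness. -/
theorem IsOMinimal.finite_of_countable (h : IsOMinimal L ℝ) {P : ℝ → Prop}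
    (hP : RealDef L (fun v : Fin 1 → ℝ => P (v 0))) (hs : {t | P t}.Countable) :
    {t | P t}.Finite := by
  by_contra hc
  obtain ⟨a, b, hab, hsub⟩ := h.exists_Ioo_subset hP hc
  exact not_countable_Ioo hab (hs.mono fun t ht => hsub t ht.1 ht.2)

end OMinimal

/-! ### Counting the points of the fibres of a planar set -/

section Fibres

open Topology Filter

/-- Every point of `s` is `ε`-close to exactly one point of `t`. -/
def UniquelyClose (ε : ℝ) (s t : ℝ → Prop) : Prop :=
  ∀ y, s y → ∃ y', (t y' ∧ y < y' + ε ∧ y' < y + ε) ∧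
    ∀ z, (t z ∧ y < z + ε ∧ z < y + ε) → z = y'

/-- Near `t`, the fibres of `A` are matched with the fibre over `t` by proximity. -/
def LocallyMatched (A : ℝ → ℝ → Prop) (t : ℝ) : Prop :=
  ∃ ε, 0 < ε ∧ ∃ a, a < t ∧ ∃ b, t < b ∧ ∀ t', (a < t' ∧ t' < b) →
    UniquelyClose ε (A t) (A t') ∧ UniquelyClose ε (A t') (A t)

/-- The fibre of `A` over `t` is contained in the union of the given intervals, each of which
contains exactly one of its points. -/
def IsolatedBy (A : ℝ → ℝ → Prop) (F : Finset (ℚ × ℚ)) (t : ℝ) : Prop :=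
  (∀ y, A t y → ∃ p ∈ F, (p.1 : ℝ) < y ∧ y < p.2) ∧
    ∀ p ∈ F, ∃ y, (A t y ∧ (p.1 : ℝ) < y ∧ y < p.2) ∧
      ∀ z, (A t z ∧ (p.1 : ℝ) < z ∧ z < p.2) → z = y

/-- Sending a point to its close partner is injective: closeness is symmetric, and the partner has
only one close point on the other side. -/
theorem UniquelyClose.ncard_le {ε : ℝ} {s t : ℝ → Prop} (h : UniquelyClose ε s t)
    (h' : UniquelyClose ε t s) (ht : {y | t y}.Finite) :
    {y | s y}.ncard ≤ {y | t y}.ncard := by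
  choose! f hf using h
  refine Set.ncard_le_ncard_of_injOn f (fun y hy => (hf y hy).1.1) (fun y hy z hz e => ?_) ht
  obtain ⟨x, hx, hx'⟩ := h' (f y) (hf y hy).1.1
  rw [hx' y ⟨hy, (hf y hy).1.2.2, (hf y hy).1.2.1⟩]
  refine (hx' z ⟨hz, ?_, ?_⟩).symm
  · rw [e]; exact (hf z hz).1.2.2
  · rw [e]; exact (hf z hz).1.2.1

theorem LocallyMatched.eventually_ncard_eq {A : ℝ → ℝ → Prop} (hA : ∀ t, {y | A t y}.Finite)
    {t : ℝ} (h : LocallyMatched A t) :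
    ∀ᶠ t' in 𝓝 t, {y | A t' y}.ncard = {y | A t y}.ncard := by
  obtain ⟨ε, -, a, ha, b, hb, H⟩ := h
  filter_upwards [Ioo_mem_nhds ha hb] with t' ht'
  obtain ⟨h1, h2⟩ := H t' ht'
  exact le_antisymm (h2.ncard_le h1 (hA t)) (h1.ncard_le h2 (hA t'))

theorem exists_gap {s : Set ℝ} (hs : s.Finite) :
    ∃ δ > 0, ∀ y ∈ s, ∀ z ∈ s, |y - z| < δ → y = z := by
  have hfin : ((s ×ˢ s) ∩ {p | p.1 ≠ p.2}).Finite := (hs.prod hs).subset Set.inter_subset_left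
  have hfin' := hfin.image (fun p : ℝ × ℝ => |p.1 - p.2|)
  have hpos : ∀ r ∈ (fun p : ℝ × ℝ => |p.1 - p.2|) '' ((s ×ˢ s) ∩ {p | p.1 ≠ p.2}), 0 < r := by
    rintro _ ⟨p, ⟨-, hp⟩, rfl⟩
    exact abs_pos.2 (sub_ne_zero.2 hp)
  have : ∀ᶠ δ in 𝓝[>] (0 : ℝ),
      ∀ r ∈ (fun p : ℝ × ℝ => |p.1 - p.2|) '' ((s ×ˢ s) ∩ {p | p.1 ≠ p.2}), δ < r := by
    rw [eventually_all_finite hfin']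
    intro r hr
    exact mem_nhdsWithin_of_mem_nhds (Iio_mem_nhds (hpos r hr))
  obtain ⟨δ, h1, h2⟩ := (this.and self_mem_nhdsWithin).exists
  refine ⟨δ, h2, fun y hy z hz hd => ?_⟩
  by_contra hne
  exact absurd (h1 _ ⟨(y, z), ⟨⟨hy, hz⟩, hne⟩, rfl⟩) hd.not_gt

/-- Put a rational interval of radius less than `δ` around each point of the fibre; since the points
are at least `2 * δ` apart, no interval sees the point of another. -/
theorem exists_isolatedBy {A : ℝ → ℝ → Prop} {t : ℝ} (hA : {y | A t y}.Finite) {δ : ℝ}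
    (hδ : 0 < δ) (hgap : ∀ y, A t y → ∀ z, A t z → |y - z| < 2 * δ → y = z) :
    ∃ F : Finset (ℚ × ℚ), IsolatedBy A F t ∧
      (∀ p ∈ F, ∃ y, A t y ∧ (p.1 : ℝ) < y ∧ y < p.2 ∧ y - δ < p.1 ∧ p.2 < y + δ) ∧
      ∀ p ∈ F, ∀ q ∈ F, ∀ y, A t y → ((p.1 : ℝ) < y ∧ y < p.2) → ((q.1 : ℝ) < y ∧ y < q.2) →
        p = q := by
  have : ∀ y : ℝ, ∃ p : ℚ × ℚ, (p.1 : ℝ) < y ∧ y < p.2 ∧ y - δ < p.1 ∧ p.2 < y + δ := by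
    intro y
    obtain ⟨q, h1, h2⟩ := exists_rat_btwn (show y - δ < y by linarith)
    obtain ⟨r, h3, h4⟩ := exists_rat_btwn (show y < y + δ by linarith)
    exact ⟨(q, r), h2, h3, h1, h4⟩
  choose p hp using this
  classical
  refine ⟨hA.toFinset.image p, ⟨fun y hy => ⟨p y, ?_, (hp y).1, (hp y).2.1⟩, ?_⟩, ?_, ?_⟩
  · exact Finset.mem_image_of_mem _ (hA.mem_toFinset.2 hy)
  · intro q hq
    obtain ⟨y, hy, rfl⟩ := Finset.mem_image.1 hq
    have hy' : A t y := hA.mem_toFinset.1 hy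
    refine ⟨y, ⟨hy', (hp y).1, (hp y).2.1⟩, fun z hz => hgap z hz.1 y hy' ?_⟩
    rw [abs_lt]
    constructor <;> linarith [(hp y).2.2.1, (hp y).2.2.2, hz.2.1, hz.2.2]
  · intro q hq
    obtain ⟨y, hy, rfl⟩ := Finset.mem_image.1 hq
    exact ⟨y, hA.mem_toFinset.1 hy, hp y⟩
  · intro q hq r hr x hx hqx hrx
    obtain ⟨y, hy, rfl⟩ := Finset.mem_image.1 hq
    obtain ⟨z, hz, rfl⟩ := Finset.mem_image.1 hr
    have h1 := hgap y (hA.mem_toFinset.1 hy) x hx (by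
      rw [abs_lt]; constructor <;> linarith [(hp y).2.2.1, (hp y).2.2.2])
    have h2 := hgap z (hA.mem_toFinset.1 hz) x hx (by
      rw [abs_lt]; constructor <;> linarith [(hp z).2.2.1, (hp z).2.2.2])
    rw [h1, h2]

/-- If `F` isolates the fibre over `t` and `t` is not a frontier point of the set where `F` does so,
then `F` isolates all nearby fibres, and sharing an interval of `F` matches their points with those
over `t`. -/
theorem locallyMatched_of_notMem_frontier {A : ℝ → ℝ → Prop} {t : ℝ} (hA : {y | A t y}.Finite)
    (h : ∀ F : Finset (ℚ × ℚ), t ∉ frontier {t | IsolatedBy A F t}) : LocallyMatched A t := by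
  obtain ⟨δ, hδ, hgap⟩ := exists_gap hA
  obtain ⟨F, hF, hFy, hFu⟩ := exists_isolatedBy (δ := δ / 2) hA (by linarith)
    (fun y hy z hz hd => hgap y hy z hz (by linarith))
  have hint : t ∈ interior {t | IsolatedBy A F t} := by
    by_contra hc
    exact h F ⟨subset_closure hF, hc⟩
  rw [mem_interior_iff_mem_nhds, mem_nhds_iff_exists_Ioo_subset] at hint
  obtain ⟨a, b, ⟨ha, hb⟩, hsub⟩ := hint
  refine ⟨δ / 2, by linarith, a, ha, b, hb, fun t' ht' => ?_⟩
  obtain ⟨hc, hu⟩ := hsub ht'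
  constructor
  · intro y hy
    obtain ⟨p, hpF, hp1, hp2⟩ := hF.1 y hy
    obtain ⟨x, hx, hx1, hx2, hx3, hx4⟩ := hFy p hpF
    obtain rfl : x = y := hgap x hx y hy (by rw [abs_lt]; constructor <;> linarith)
    obtain ⟨y', hy', huy'⟩ := hu p hpF
    refine ⟨y', ⟨hy'.1, by linarith [hy'.2.1], by linarith [hy'.2.2]⟩, fun z hz => huy' z ?_⟩
    obtain ⟨q, hqF, hq1, hq2⟩ := hc z hz.1
    obtain ⟨w, hw, hw1, hw2, hw3, hw4⟩ := hFy q hqF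
    obtain rfl : x = w := hgap x hx w hw
      (by rw [abs_lt]; constructor <;> linarith [hz.2.1, hz.2.2])
    obtain rfl := hFu p hpF q hqF x hx ⟨hx1, hx2⟩ ⟨hw1, hw2⟩
    exact ⟨hz.1, hq1, hq2⟩
  · intro y' hy'
    obtain ⟨p, hpF, hp1, hp2⟩ := hc y' hy'
    obtain ⟨x, hx, hx1, hx2, hx3, hx4⟩ := hFy p hpF
    refine ⟨x, ⟨hx, by linarith, by linarith⟩, fun z hz => ?_⟩
    exact hgap z hz.1 x hx (by rw [abs_lt]; constructor <;> linarith [hz.2.1, hz.2.2])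

/-- There are only countably many finite families of rational intervals, and each contributes
finitely many frontier points. -/
theorem countable_not_locallyMatched {A : ℝ → ℝ → Prop} (hA : ∀ t, {y | A t y}.Finite)
    (h : ∀ F : Finset (ℚ × ℚ), (frontier {t | IsolatedBy A F t}).Finite) :
    {t | ¬ LocallyMatched A t}.Countable := by
  refine (Set.countable_iUnion fun F : Finset (ℚ × ℚ) => (h F).countable).mono fun t ht => ?_
  by_contra hc
  simp only [Set.mem_iUnion, not_exists] at hc
  exact ht (locallyMatched_of_notMem_frontier (hA t) hc)

/-- Near matched points the fibre size is locally constant, hence constant on connected sets. -/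
theorem ncard_eq_of_locallyMatched {A : ℝ → ℝ → Prop} (hA : ∀ t, {y | A t y}.Finite)
    {s : Set ℝ} (hs : IsPreconnected s) (h : ∀ t ∈ s, LocallyMatched A t) {t t' : ℝ} (ht : t ∈ s)
    (ht' : t' ∈ s) : {y | A t y}.ncard = {y | A t' y}.ncard := by
  refine hs.constant (f := fun t => {y | A t y}.ncard) (fun x hx => ?_) ht ht'
  refine ContinuousAt.continuousWithinAt ?_
  rw [ContinuousAt, nhds_discrete ℕ, tendsto_pure]
  exact (h x hx).eventually_ncard_eq hA

/-- A finite set together with sample points from all the components of its complement. -/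
def Sample (B : ℝ → Prop) (s : ℝ) : Prop :=
  (B s ∨ s = 0) ∨ (∃ b, B b ∧ (s = b + 1 ∨ s + 1 = b)) ∨ ∃ b, B b ∧ ∃ b', B b' ∧ s + s = b + b'

theorem Sample.finite {B : ℝ → Prop} (hB : {t | B t}.Finite) : {s | Sample B s}.Finite := by
  have h1 : {s | B s ∨ s = 0}.Finite := hB.union (Set.finite_singleton 0)
  have h2 : {s | ∃ b, B b ∧ (s = b + 1 ∨ s + 1 = b)}.Finite := by
    refine ((hB.image (· + 1)).union (hB.image (· - 1))).subset ?_
    rintro s ⟨b, hb, h | h⟩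
    · exact Or.inl ⟨b, hb, h.symm⟩
    · exact Or.inr ⟨b, hb, by simp [← h]⟩
  have h3 : {s | ∃ b, B b ∧ ∃ b', B b' ∧ s + s = b + b'}.Finite := by
    refine (hB.image2 (fun b b' => (b + b') / 2) hB).subset ?_
    rintro s ⟨b, hb, b', hb', h⟩
    exact ⟨b, hb, b', hb', by simp only; linarith⟩
  exact h1.union (h2.union h3)

/-- Take the midpoint of the two neighbours of `t` in `B`, a point one unit beyond the only
neighbour, or `0` if `B` is empty. -/
theorem exists_sample {B : ℝ → Prop} (hB : {t | B t}.Finite) {t : ℝ} (ht : ¬ B t) :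
    ∃ s, Sample B s ∧ ∀ x ∈ Set.uIcc t s, ¬ B x := by
  have hlo : (∀ b, B b → t ≤ b) ∨ ∃ b, B b ∧ b < t ∧ ∀ c, B c → c < t → c ≤ b := by
    rcases ({b | B b ∧ b < t}).eq_empty_or_nonempty with he | hne
    · left
      intro b hb
      by_contra hc
      exact (he ▸ (⟨hb, not_le.1 hc⟩ : b ∈ {b | B b ∧ b < t}) : b ∈ (∅ : Set ℝ))
    · right
      obtain ⟨b, hb, hmax⟩ := Set.exists_max_image _ id (hB.subset fun b hb => hb.1) hne
      exact ⟨b, hb.1, hb.2, fun c hc hct => hmax c ⟨hc, hct⟩⟩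
  have hhi : (∀ b, B b → b ≤ t) ∨ ∃ b, B b ∧ t < b ∧ ∀ c, B c → t < c → b ≤ c := by
    rcases ({b | B b ∧ t < b}).eq_empty_or_nonempty with he | hne
    · left
      intro b hb
      by_contra hc
      exact (he ▸ (⟨hb, not_le.1 hc⟩ : b ∈ {b | B b ∧ t < b}) : b ∈ (∅ : Set ℝ))
    · right
      obtain ⟨b, hb, hmin⟩ := Set.exists_min_image _ id (hB.subset fun b hb => hb.1) hne
      exact ⟨b, hb.1, hb.2, fun c hc hct => hmin c ⟨hc, hct⟩⟩
  have hne : ∀ x, B x → x ≠ t := fun x hx e => ht (e ▸ hx)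
  rcases hlo with hlo | ⟨b, hb, hbt, hbm⟩ <;> rcases hhi with hhi | ⟨b', hb', hbt', hbm'⟩
  · exact ⟨0, Or.inl (Or.inr rfl), fun x _ hx => hne x hx (le_antisymm (hhi x hx) (hlo x hx))⟩
  · refine ⟨b' - 1, Or.inr (Or.inl ⟨b', hb', Or.inr (by ring)⟩), fun x hx hBx => ?_⟩
    have h1 := hbm' x hBx (lt_of_le_of_ne (hlo x hBx) (hne x hBx).symm)
    rcases Set.mem_uIcc.1 hx with h | h <;> linarith [h.1, h.2]
  · refine ⟨b + 1, Or.inr (Or.inl ⟨b, hb, Or.inl rfl⟩), fun x hx hBx => ?_⟩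
    have h1 := hbm x hBx (lt_of_le_of_ne (hhi x hBx) (hne x hBx))
    rcases Set.mem_uIcc.1 hx with h | h <;> linarith [h.1, h.2]
  · refine ⟨(b + b') / 2, Or.inr (Or.inr ⟨b, hb, b', hb', by ring⟩), fun x hx hBx => ?_⟩
    rcases lt_or_gt_of_ne (hne x hBx) with h2 | h2
    · have h1 := hbm x hBx h2
      rcases Set.mem_uIcc.1 hx with h | h <;> linarith [h.1, h.2]
    · have h1 := hbm' x hBx h2
      rcases Set.mem_uIcc.1 hx with h | h <;> linarith [h.1, h.2]

theorem ncard_le_of_sample {A : ℝ → ℝ → Prop} (hA : ∀ t, {y | A t y}.Finite)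
    (hB : {t | ¬ LocallyMatched A t}.Finite) {k : ℕ}
    (h : ∀ s, Sample (fun t => ¬ LocallyMatched A t) s → {y | A s y}.ncard ≤ k) (t : ℝ) :
    {y | A t y}.ncard ≤ k := by
  by_cases ht : LocallyMatched A t
  · obtain ⟨s, hs, hI⟩ := exists_sample hB (t := t) (not_not.2 ht)
    rw [ncard_eq_of_locallyMatched hA isPreconnected_uIcc (fun x hx => not_not.1 (hI x hx))
      Set.left_mem_uIcc Set.right_mem_uIcc]
    exact h s hs
  · exact h t (Or.inl (Or.inl ht))

end Fibres

/-! ### Uniform finiteness, by induction on the number of parameters -/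

section UniformFiniteness

variable {L : FirstOrder.Language.{u, v}} [L.Structure ℝ] {α : Type}

theorem RealDef.true : RealDef L (fun _ : α → ℝ => True) := ⟨⊤, fun _ => by simp⟩

theorem RealDef.false : RealDef L (fun _ : α → ℝ => False) := ⟨⊥, fun _ => by simp⟩

theorem RealDef.forall_mem_finset {κ : Type} (F : Finset κ) {P : κ → (α → ℝ) → Prop}
    (h : ∀ p, RealDef L (P p)) : RealDef L (fun v => ∀ p ∈ F, P p v) := by
  classical
  induction F using Finset.induction_on with
  | empty => exact RealDef.true.congr fun v => by simp
  | insert p F _ ih => exact ((h p).and ih).congr fun v => by simp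

theorem RealDef.exists_mem_finset {κ : Type} (F : Finset κ) {P : κ → (α → ℝ) → Prop}
    (h : ∀ p, RealDef L (P p)) : RealDef L (fun v => ∃ p ∈ F, P p v) := by
  classical
  induction F using Finset.induction_on with
  | empty => exact RealDef.false.congr fun v => by simp
  | insert p F _ ih => exact ((h p).or ih).congr fun v => by simp

/-- Here the tuple `x` and the family `F` are fixed, which suffices to bound the frontier for each
`F` separately. -/
theorem RealDef₂.isolatedBy (ι : oaddLang →ᴸ L) [ι.IsExpansionOn ℝ]
    {R : (α → ℝ) → ℝ → ℝ → Prop} (hR : RealDef₂ L R) (x : α → ℝ) (F : Finset (ℚ × ℚ)) :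
    RealDef L (fun v : Fin 1 → ℝ => IsolatedBy (R x) F (v 0)) := by
  unfold IsolatedBy
  refine RealDef.and (RealDef.all (RealDef.imp ?_ (RealDef.exists_mem_finset _ fun p => ?_)))
    (RealDef.forall_mem_finset _ fun p => RealDef.ex (RealDef.and ?_ (RealDef.all ?_)))
  all_goals
    repeat' first
    | apply RealDef.and | apply RealDef.imp | apply RealDef.lt ι | apply RealDef.eq
    | apply RealDef₂.subst hR | intro _ | apply RealTerm.const | apply RealTerm.var

/-- Matching by proximity quantifies over `ε` instead of over rational families, so one formula,
using only `<` and `+`, works uniformly in `x`. -/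
theorem RealDef₂.locallyMatched (ι : oaddLang →ᴸ L) [ι.IsExpansionOn ℝ]
    {R : (α → ℝ) → ℝ → ℝ → Prop} (hR : RealDef₂ L R) :
    RealDef₁ L (fun x t => LocallyMatched (R x) t) := by
  unfold LocallyMatched UniquelyClose RealDef₁
  repeat' first
    | apply RealDef.ex | apply RealDef.all
    | apply RealDef.and | apply RealDef.imp | apply RealDef.lt ι | apply RealDef.eq
    | apply RealDef₂.subst hR | intro _ | apply RealTerm.var | apply RealTerm.const
    | apply RealTerm.add ι

/-- `Sample` is phrased with `s + 1 = b` and `s + s = b + b'` so that addition alone defines it,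
without subtraction or halving. -/
theorem RealDef₁.sample (ι : oaddLang →ᴸ L) [ι.IsExpansionOn ℝ]
    {B : (α → ℝ) → ℝ → Prop} (hB : RealDef₁ L B) :
    RealDef₁ L (fun x t => Sample (B x) t) := by
  unfold Sample RealDef₁
  repeat' first
    | apply RealDef.ex
    | apply RealDef.and | apply RealDef.or | apply RealDef.eq
    | apply RealDef₁.subst hB | intro _ | apply RealTerm.var | apply RealTerm.const
    | apply RealTerm.add ι

/-- Definable families of finite subsets of the line have bounded size. -/
def UniformlyFinite (L : FirstOrder.Language.{u, v}) [L.Structure ℝ] (α : Type) : Prop :=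
  ∀ R : (α → ℝ) → ℝ → Prop, RealDef₁ L R → (∀ x, {y | R x y}.Finite) →
    ∃ k : ℕ, ∀ x, {y | R x y}.ncard ≤ k

theorem UniformlyFinite.of_equiv {β : Type} (e : α ≃ β) (h : UniformlyFinite L α) :
    UniformlyFinite L β := by
  intro R hR hfin
  obtain ⟨k, hk⟩ := h (fun x y => R (x ∘ e.symm) y)
    (RealDef₁.subst hR (fun i => RealTerm.var (Sum.inl (e.symm i))) (RealTerm.var (Sum.inr 0)))
    (fun x => hfin _)
  refine ⟨k, fun x => ?_⟩
  have := hk (x ∘ e)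
  rwa [Function.comp_assoc, e.self_comp_symm, Function.comp_id] at this

/-- Let `t` be the last parameter. For fixed `x` only finitely many `t` are not locally matched, and
fibre sizes are constant between them. So every fibre is as large as one over a sample point. The
union of the fibres over the finitely many sample points is a definable finite set depending on `x`
alone, and the inductive bound for it bounds all fibres. -/
theorem UniformlyFinite.succ (ι : oaddLang →ᴸ L) [ι.IsExpansionOn ℝ] (homin : IsOMinimal L ℝ)
    (h : UniformlyFinite L α) : UniformlyFinite L (α ⊕ Fin 1) := by
  intro R hR hfin
  set A : (α → ℝ) → ℝ → ℝ → Prop := fun x t y => R (Sum.elim x (fun _ => t)) y with hAdef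
  have hA : RealDef₂ L A := by
    refine RealDef.congr hR fun w => iff_of_eq ?_
    simp only [hAdef]
    congr 1
    funext i
    rcases i with i | i
    · rfl
    · rw [Subsingleton.elim i 0]; rfl
  have hAfin : ∀ x t, {y | A x t y}.Finite := fun x t => hfin _
  have hBad : RealDef₁ L (fun x t => ¬ LocallyMatched (A x) t) := (hA.locallyMatched ι).not
  have hBfin : ∀ x, {t | ¬ LocallyMatched (A x) t}.Finite := by
    intro x
    refine homin.finite_of_countable ?_ (countable_not_locallyMatched (hAfin x) fun F =>
      homin.finite_frontier (hA.isolatedBy ι x F))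
    exact hBad.subst (fun i => RealTerm.const (x i)) (RealTerm.var 0)
  have hUfin : ∀ x,
      {y | ∃ s, Sample (fun t => ¬ LocallyMatched (A x) t) s ∧ A x s y}.Finite := by
    intro x
    refine ((Sample.finite (hBfin x)).biUnion fun s _ => hAfin x s).subset ?_
    rintro y ⟨s, hs, hy⟩
    exact Set.mem_biUnion hs hy
  obtain ⟨k, hk⟩ := h
    (fun x y => ∃ s, Sample (fun t => ¬ LocallyMatched (A x) t) s ∧ A x s y) (by
      refine RealDef.ex (RealDef.and ?_ ?_)
      · exact (hBad.sample ι).subst (fun i => RealTerm.var (Sum.inl (Sum.inl i)))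
          (RealTerm.var (Sum.inr 0))
      · exact hA.subst (fun i => RealTerm.var (Sum.inl (Sum.inl i)))
          (RealTerm.var (Sum.inr 0)) (RealTerm.var (Sum.inl (Sum.inr 0))))
    hUfin
  refine ⟨k, fun w => ?_⟩
  have key := ncard_le_of_sample (hAfin (w ∘ Sum.inl)) (hBfin (w ∘ Sum.inl)) (k := k)
    (fun s hs => le_trans (Set.ncard_le_ncard (by exact fun y hy => ⟨s, hs, hy⟩)
      (hUfin _)) (hk (w ∘ Sum.inl))) (w (Sum.inr 0))
  have hw : Sum.elim (w ∘ Sum.inl) (fun _ => w (Sum.inr 0)) = w := by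
    funext i
    rcases i with i | i
    · rfl
    · rw [Subsingleton.elim i 0]; rfl
  simpa only [hAdef, hw] using key

theorem uniformlyFinite (ι : oaddLang →ᴸ L) [ι.IsExpansionOn ℝ] (homin : IsOMinimal L ℝ)
    (α : Type) [Finite α] : UniformlyFinite L α := by
  have hfin : ∀ n, UniformlyFinite L (Fin n) := by
    intro n
    induction n with
    | zero =>
      intro R _ _
      refine ⟨{y | R default y}.ncard, fun x => ?_⟩
      rw [Subsingleton.elim x default]
    | succ n ih => exact (ih.succ ι homin).of_equiv finSumFinEquiv
  exact (hfin (Nat.card α)).of_equiv (Finite.equivFin α).symm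

/-- In an o-minimal expansion of the reals, the members of a definable family of subsets of the
line with sufficiently many elements contain an interval. -/
theorem exists_ncard_bound (ι : oaddLang →ᴸ L) [ι.IsExpansionOn ℝ] (homin : IsOMinimal L ℝ)
    [Finite α] {R : (α → ℝ) → ℝ → Prop} (hR : RealDef₁ L R) :
    ∃ k : ℕ, ∀ x, {y | R x y}.Finite → {y | R x y}.ncard ≤ k := by
  have hR₁ : ∀ x, RealDef L (fun v : Fin 1 → ℝ => R x (v 0)) := fun x =>
    hR.subst (fun i => RealTerm.const (x i)) (RealTerm.var 0)
  set I : (α → ℝ) → Prop :=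
    fun x => ∃ a, ∃ b, a < b ∧ ∀ t, a < t → t < b → R x t with hIdef
  have hI : ∀ x, {y | R x y}.Finite ↔ ¬ I x := by
    intro x
    refine ⟨fun hf ⟨a, b, hab, h⟩ => ?_, fun h => ?_⟩
    · exact Set.Ioo_infinite hab (hf.subset fun t ht => h t ht.1 ht.2)
    · by_contra hc
      exact h (homin.exists_Ioo_subset (hR₁ x) hc)
  -- Containing an interval is a definable condition equivalent to being infinite, so the infinite
  -- fibres can be emptied definably.
  have hdef : RealDef₁ L (fun x y => R x y ∧ ¬ I x) := by
    refine RealDef.and hR (RealDef.not ?_)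
    simp only [hIdef]
    repeat' first
      | apply RealDef.ex | apply RealDef.all
      | apply RealDef.and | apply RealDef.imp | apply RealDef.lt ι
      | apply RealDef₁.subst hR | intro _ | apply RealTerm.var
  obtain ⟨k, hk⟩ := uniformlyFinite ι homin α _ hdef fun x => by
    by_cases hx : I x
    · simp [hx]
    · exact ((hI x).2 hx).subset fun y hy => hy.1
  refine ⟨k, fun x hx => ?_⟩
  have := hk x
  simpa only [(hI x).1 hx, not_false_eq_true, and_true] using this

end UniformFiniteness

/-! ### Algebraic closure -/

section Acl

variable {L : FirstOrder.Language.{u, v}} {M : Type w} [L.Structure M] {α β : Type}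

/-- The set of solutions `x` of `φ(a, x)`. -/
def sol (φ : L.Formula (α ⊕ Fin 1)) (a : α → M) : Set M :=
  {x | φ.Realize (Sum.elim a fun _ => x)}

theorem mem_sol {φ : L.Formula (α ⊕ Fin 1)} {a : α → M} {x : M} :
    x ∈ sol φ a ↔ φ.Realize (Sum.elim a fun _ => x) := Iff.rfl

theorem mem_sol_relabel {φ : L.Formula (α ⊕ Fin 1)} {f : α → β} {b : β → M} {x : M} :
    x ∈ sol (φ.relabel (Sum.map f id)) b ↔ x ∈ sol φ (b ∘ f) := by
  rw [mem_sol, Formula.realize_relabel, Sum.elim_comp_map, Function.comp_id, mem_sol]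

theorem sol_relabel (φ : L.Formula (α ⊕ Fin 1)) (f : α → β) (b : β → M) :
    sol (φ.relabel (Sum.map f id)) b = sol φ (b ∘ f) :=
  Set.ext fun _ => mem_sol_relabel

theorem realize_existsGE {k : ℕ} {φ : L.Formula (α ⊕ Fin 1)} {a : α → M} :
    (existsGE k φ).Realize a ↔ ∃ y : Fin k → M, Function.Injective y ∧ ∀ i, y i ∈ sol φ a := by
  simp only [existsGE, Formula.realize_iExs, Formula.realize_inf, Formula.realize_iInf,
    Formula.realize_relabel, Formula.realize_not, Formula.realize_equal, Term.realize_var,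
    Sum.elim_inr, mem_sol]
  refine exists_congr fun y => ?_
  rw [and_comm]
  refine and_congr ?_ (forall_congr' fun i => iff_of_eq ?_)
  · refine ⟨fun h i j hij => ?_, fun h ij hij => ij.2 (h hij)⟩
    by_contra hne
    exact h ⟨(i, j), hne⟩ hij
  · congr 1
    funext z
    rcases z with z | z <;> rfl

theorem realize_existsGE_iff_encard {k : ℕ} {φ : L.Formula (α ⊕ Fin 1)} {a : α → M} :
    (existsGE k φ).Realize a ↔ (k : ℕ∞) ≤ (sol φ a).encard := by
  rw [realize_existsGE]
  constructor
  · rintro ⟨y, hy, hmem⟩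
    have h1 : (Set.range y).encard = k := by
      rw [← Set.image_univ, hy.injOn.encard_image]
      simp
    rw [← h1]
    exact Set.encard_le_encard (Set.range_subset_iff.2 hmem)
  · intro h
    obtain ⟨t, ht, hk⟩ := Set.exists_subset_encard_eq h
    have hfin : t.Finite := Set.finite_of_encard_eq_coe hk
    have hcard : Nat.card t = k := by
      have := hfin.cast_ncard_eq
      rw [hk] at this
      exact_mod_cast this
    have : Finite t := hfin
    let e : Fin k ≃ t := (finCongr hcard.symm).trans (Finite.equivFin t).symm
    exact ⟨fun i => e i, fun i j hij => e.injective (Subtype.ext hij), fun i => ht (e i).2⟩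

theorem finite_sol_of_not_realize_existsGE {k : ℕ} {φ : L.Formula (α ⊕ Fin 1)} {a : α → M}
    (h : ¬ (existsGE k φ).Realize a) : (sol φ a).Finite := by
  rw [realize_existsGE_iff_encard] at h
  by_contra hc
  rw [Set.Infinite.encard_eq hc] at h
  exact h le_top

theorem exists_not_realize_existsGE {φ : L.Formula (α ⊕ Fin 1)} {a : α → M}
    (h : (sol φ a).Finite) : ∃ k, ¬ (existsGE k φ).Realize a := by
  refine ⟨(sol φ a).ncard + 1, ?_⟩
  rw [realize_existsGE_iff_encard, ← h.cast_ncard_eq]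
  simp only [not_le]
  exact_mod_cast Nat.lt_succ_self _

theorem infinite_sol_iff {φ : L.Formula (α ⊕ Fin 1)} {a : α → M} :
    (sol φ a).Infinite ↔ ∀ k, (existsGE k φ).Realize a := by
  refine ⟨fun h k => ?_, fun h hf => ?_⟩
  · by_contra hc
    exact h (finite_sol_of_not_realize_existsGE hc)
  · obtain ⟨k, hk⟩ := exists_not_realize_existsGE hf
    exact hk (h k)

/-- Interchange the last two variables of a formula. -/
def swapVars (χ : L.Formula ((α ⊕ Fin 1) ⊕ Fin 1)) : L.Formula ((α ⊕ Fin 1) ⊕ Fin 1) :=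
  χ.relabel (Sum.elim (Sum.elim (Sum.inl ∘ Sum.inl) Sum.inr) (Sum.inl ∘ Sum.inr))

theorem mem_sol_swapVars {χ : L.Formula ((α ⊕ Fin 1) ⊕ Fin 1)} {a : α → M} {x y : M} :
    y ∈ sol (swapVars χ) (Sum.elim a fun _ => x) ↔
      χ.Realize (Sum.elim (Sum.elim a fun _ => y) fun _ => x) := by
  rw [mem_sol, swapVars, Formula.realize_relabel]
  refine iff_of_eq ?_
  congr 1
  funext i
  rcases i with (i | i) | i <;> rfl

variable (L) in
/-- The algebraic closure of a set: the union of the finite sets definable over it. -/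
def acl (A : Set M) : Set M :=
  {c | ∃ (α : Type) (_ : Finite α) (ψ : L.Formula (α ⊕ Fin 1)) (a : α → M),
    (∀ i, a i ∈ A) ∧ c ∈ sol ψ a ∧ (sol ψ a).Finite}

theorem acl_mono {A B : Set M} (h : A ⊆ B) : acl L A ⊆ acl L B := by
  rintro c ⟨α, hα, ψ, a, ha, hc⟩
  exact ⟨α, hα, ψ, a, fun i => h (ha i), hc⟩

theorem subset_acl (A : Set M) : A ⊆ acl L A := by
  intro c hc
  refine ⟨Fin 1, inferInstance, Term.equal (Term.var (Sum.inr 0)) (Term.var (Sum.inl 0)),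
    fun _ => c, fun _ => hc, ?_, (Set.finite_singleton c).subset fun x hx => ?_⟩
  · simp [mem_sol]
  · simpa [mem_sol] using hx

theorem acl_finite_character {A : Set M} {c : M} (hc : c ∈ acl L A) :
    ∃ A₀ ⊆ A, A₀.Finite ∧ c ∈ acl L A₀ := by
  obtain ⟨α, hα, ψ, a, ha, hc⟩ := hc
  exact ⟨Set.range a, Set.range_subset_iff.2 ha, Set.finite_range a, α, hα, ψ, a,
    fun i => ⟨i, rfl⟩, hc⟩

/-- The parameters `b` are quantified out: each ranges over a finite set defined over `A`. Adding to
`ψ` the bound "fewer than `k` solutions" keeps the solution set finite for every choice of them, not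
just for `b`. -/
theorem acl_subset_of_subset_acl {A B : Set M} (h : B ⊆ acl L A) : acl L B ⊆ acl L A := by
  rintro c ⟨β, hβ, ψ, b, hb, hc, hfin⟩
  choose α hα θ a ha hmem hfin' using fun i => h (hb i)
  obtain ⟨k, hk⟩ := exists_not_realize_existsGE hfin
  let χ : L.Formula (((Σ i, α i) ⊕ Fin 1) ⊕ β) :=
    Formula.iInf (fun i : β => (θ i).relabel
      (Sum.elim (fun j => Sum.inl (Sum.inl ⟨i, j⟩)) (fun _ => Sum.inr i))) ⊓
    (ψ ⊓ ((existsGE k ψ).not.relabel Sum.inl)).relabel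
      (Sum.elim Sum.inr (fun _ => Sum.inl (Sum.inr 0)))
  have hχ : ∀ x, x ∈ sol (χ.iExs β) (fun p : Σ i, α i => a p.1 p.2) ↔
      ∃ y : β → M, (∀ i, y i ∈ sol (θ i) (a i)) ∧ x ∈ sol ψ y ∧ ¬ (existsGE k ψ).Realize y := by
    intro x
    simp only [mem_sol, χ, Formula.realize_iExs, Formula.realize_inf, Formula.realize_iInf,
      Formula.realize_relabel, Formula.realize_not, Sum.comp_elim]
    rfl
  refine ⟨Σ i, α i, inferInstance, χ.iExs β, fun p => a p.1 p.2, fun p => ha _ _,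
    (hχ c).2 ⟨b, hmem, hc, hk⟩, ?_⟩
  refine Set.Finite.subset (Set.Finite.biUnion (Set.Finite.pi' hfin')
    (t := fun y => {x | x ∈ sol ψ y ∧ ¬ (existsGE k ψ).Realize y}) ?_) ?_
  · intro y _
    by_cases hy : (existsGE k ψ).Realize y
    · simp [hy]
    · exact (finite_sol_of_not_realize_existsGE hy).subset fun x hx => hx.1
  · intro x hx
    obtain ⟨y, hy1, hy2⟩ := (hχ x).1 hx
    exact Set.mem_iUnion₂.2 ⟨y, hy1, hy2⟩

theorem sol_comp_equiv {N : Type w'} [L.Structure N] (f : M ≃[L] N) (φ : L.Formula (α ⊕ Fin 1))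
    (a : α → M) : sol φ (f ∘ a) = f '' sol φ a := by
  have key : ∀ x, f x ∈ sol φ (f ∘ a) ↔ x ∈ sol φ a := by
    intro x
    rw [mem_sol, mem_sol, ← StrongHomClass.realize_formula f φ]
    refine iff_of_eq ?_
    congr 1
    funext i
    rcases i with i | i <;> rfl
  ext y
  obtain ⟨x, rfl⟩ := f.surjective y
  rw [key]
  exact ⟨fun h => ⟨x, h, rfl⟩, fun ⟨z, hz, e⟩ => f.injective e ▸ hz⟩

theorem image_acl_subset {N : Type w'} [L.Structure N] (f : M ≃[L] N) (A : Set M) :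
    f '' acl L A ⊆ acl L (f '' A) := by
  rintro _ ⟨c, ⟨α, hα, ψ, a, ha, hc, hfin⟩, rfl⟩
  refine ⟨α, hα, ψ, f ∘ a, fun i => ⟨a i, ha i, rfl⟩, ?_, ?_⟩
  · rw [sol_comp_equiv]; exact ⟨c, hc, rfl⟩
  · rw [sol_comp_equiv]; exact hfin.image f

theorem acl_eq_univ_of_image (f : M ≃[L] M) {A B : Set M} (hf : f '' A = B)
    (hB : acl L B = Set.univ) : acl L A = Set.univ := by
  refine Set.eq_univ_of_forall fun c => ?_
  have h1 : f c ∈ acl L B := hB ▸ Set.mem_univ _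
  have h2 := image_acl_subset f.symm B ⟨f c, h1, rfl⟩
  have h3 : f.symm '' B = A := by
    rw [← hf, Set.image_image]; simp
  rw [h3] at h2
  simpa using h2

end Acl

/-! ### Geometric structures -/

section Geometric

variable (L : FirstOrder.Language.{u, v}) (R : Type w) [L.Structure R]

/-- Elimination of `∃^∞`, and a form of the exchange property, for a structure `R`. -/
structure IsGeometric : Prop where
  bound : ∀ {α : Type} [Finite α] (φ : L.Formula (α ⊕ Fin 1)), ∃ l : ℕ, ∀ a : α → R,
    (existsGE l φ).Realize a → (sol φ a).Infinite
  exchange : ∀ {α : Type} [Finite α] (ψ : L.Formula ((α ⊕ Fin 1) ⊕ Fin 1)) (a : α → R),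
    (∀ y, {x | ψ.Realize (Sum.elim (Sum.elim a fun _ => y) fun _ => x)}.Finite) →
    {x | {y | ψ.Realize (Sum.elim (Sum.elim a fun _ => y) fun _ => x)}.Infinite}.Finite

variable {L R} {α β : Type}

/-- The universal closure of `φ` is a sentence true in `R`, hence in every model of its complete
theory. -/
theorem transfer {M : Type w'} [L.Structure M] [M ⊨ L.completeTheory R] [Finite α]
    {φ : L.Formula α} (h : ∀ v : α → R, φ.Realize v) (v : α → M) : φ.Realize v := by
  have h1 : R ⊨ Formula.iAlls α (φ.relabel (Sum.inr : α → Empty ⊕ α)) := by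
    rw [Sentence.Realize, Formula.realize_iAlls]
    intro i
    rw [Formula.realize_relabel]
    exact h _
  rw [← realize_iff_of_model_completeTheory R M, Sentence.Realize, Formula.realize_iAlls] at h1
  have := h1 v
  rwa [Formula.realize_relabel] at this

namespace IsGeometric

variable (hg : IsGeometric L R)

/-- A number `l` such that `∃^{≥ l} x φ` means `∃^∞ x φ`. -/
noncomputable def infBound [Finite α] (φ : L.Formula (α ⊕ Fin 1)) : ℕ := (hg.bound φ).choose

/-- The formula `∃^∞ x φ`. -/
noncomputable def existsInf [Finite α] (φ : L.Formula (α ⊕ Fin 1)) : L.Formula α :=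
  existsGE (hg.infBound φ) φ

/-- The formula `φ(a, x) ∧ ¬ ∃^∞ x φ(a, x)`, which always has finitely many solutions `x`. -/
noncomputable def algPart [Finite α] (φ : L.Formula (α ⊕ Fin 1)) : L.Formula (α ⊕ Fin 1) :=
  φ ⊓ (hg.existsInf φ).not.relabel Sum.inl

theorem existsInf_imp [Finite α] (φ : L.Formula (α ⊕ Fin 1)) {M : Type w'} [L.Structure M]
    [M ⊨ L.completeTheory R] {a : α → M} (h : (hg.existsInf φ).Realize a) (m : ℕ) :
    (existsGE m φ).Realize a := by
  have : ∀ a : α → R, ((hg.existsInf φ).imp (existsGE m φ)).Realize a := fun a =>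
    Formula.realize_imp.2 fun h => infinite_sol_iff.1 ((hg.bound φ).choose_spec a h) m
  exact Formula.realize_imp.1 (transfer this a) h

theorem expressesInf [Finite α] (φ : L.Formula (α ⊕ Fin 1)) :
    ExpressesInf (L.completeTheory R) (hg.infBound φ) φ := by
  intro m M v xs
  rw [Subsingleton.elim xs default]
  exact fun h => hg.existsInf_imp φ h m

variable {M : Type w'} [L.Structure M] [M ⊨ L.completeTheory R]

theorem realize_existsInf [Finite α] {φ : L.Formula (α ⊕ Fin 1)} {a : α → M} :
    (hg.existsInf φ).Realize a ↔ (sol φ a).Infinite :=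
  ⟨fun h => infinite_sol_iff.2 (hg.existsInf_imp φ h), fun h => infinite_sol_iff.1 h _⟩

theorem sol_algPart [Finite α] {φ : L.Formula (α ⊕ Fin 1)} {a : α → M} :
    sol (hg.algPart φ) a = {x | x ∈ sol φ a ∧ (sol φ a).Finite} := by
  ext x
  simp only [algPart, mem_sol, Formula.realize_inf, Formula.realize_relabel, Formula.realize_not,
    Set.mem_ofPred_eq]
  rw [Sum.elim_comp_inl, realize_existsInf, Set.not_infinite]

theorem finite_sol_algPart [Finite α] (φ : L.Formula (α ⊕ Fin 1)) (a : α → M) :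
    (sol (hg.algPart φ) a).Finite := by
  rw [sol_algPart]
  by_cases h : (sol φ a).Finite
  · exact h.subset fun x hx => hx.1
  · simp [h]

include hg in
-- Let `χ(y, x)` witness that `c` is algebraic over `b` and `A`, made finite in `x` for all `y`. If
-- `χ(y, c)` has finitely many solutions `y`, then `b` is one of them and is algebraic. Otherwise
-- `c` is among the `x` for which there are infinitely many `y`; by exchange in `R` these are
-- finitely many, so `c` would be algebraic over `A`.
theorem acl_exchange {A : Set M} {b c : M} (hc : c ∈ acl L (insert b A)) (hcA : c ∉ acl L A) :
    b ∈ acl L (insert c A) := by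
  classical
  obtain ⟨α, hα, ψ, a, ha, hcs, hfin⟩ := hc
  let β := {i // a i ∈ A}
  -- Entries outside `A` all equal `b`, so they are merged into a single variable.
  let ρ : α → β ⊕ Fin 1 := fun i => if h : a i ∈ A then Sum.inl ⟨i, h⟩ else Sum.inr 0
  let a' : β → M := fun i => a i
  have hρ : Sum.elim a' (fun _ => b) ∘ ρ = a := by
    funext i
    by_cases h : a i ∈ A
    · simp [ρ, a', h]
    · simp only [Function.comp, ρ, h, dite_false, Sum.elim_inr]
      exact ((ha i).resolve_right h).symm
  let χ : L.Formula ((β ⊕ Fin 1) ⊕ Fin 1) := (hg.algPart ψ).relabel (Sum.map ρ id)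
  have hχ : ∀ y x, χ.Realize (Sum.elim (Sum.elim a' fun _ => y) fun _ => x) ↔
      x ∈ sol (hg.algPart ψ) (Sum.elim a' (fun _ => y) ∘ ρ) := fun y x => by
    rw [Formula.realize_relabel, mem_sol, Sum.elim_comp_map, Function.comp_id]
  have hχc : χ.Realize (Sum.elim (Sum.elim a' fun _ => b) fun _ => c) := by
    rw [hχ, hρ, sol_algPart]
    exact ⟨hcs, hfin⟩
  by_cases hY : (sol (swapVars χ) (Sum.elim a' fun _ => c)).Finite
  · refine ⟨β ⊕ Fin 1, inferInstance, swapVars χ, Sum.elim a' fun _ => c, ?_,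
      mem_sol_swapVars.2 hχc, hY⟩
    rintro (i | i)
    · exact Or.inr i.2
    · exact Or.inl rfl
  · exfalso
    refine hcA ⟨β, inferInstance, hg.existsInf (swapVars χ), a', fun i => i.2,
      hg.realize_existsInf.2 hY, ?_⟩
    -- Finiteness of a set defined by `∃^∞` is again one formula, so exchange transfers from `R` to
    -- `M`.
    have key : ∀ d : β → R,
        (hg.existsInf (hg.existsInf (swapVars χ))).not.Realize d := by
      intro d
      rw [Formula.realize_not, hg.realize_existsInf, Set.not_infinite]
      refine (hg.exchange χ d fun y => ?_).subset fun x hx => ?_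
      · refine (hg.finite_sol_algPart ψ (Sum.elim d (fun _ => y) ∘ ρ)).subset
          fun x hx => ?_
        rwa [Set.mem_ofPred_eq, Formula.realize_relabel, Sum.elim_comp_map,
          Function.comp_id] at hx
      · have := hg.realize_existsInf.1 (mem_sol.1 hx)
        exact this.mono fun y hy => mem_sol_swapVars.1 hy
    have := transfer key a'
    rwa [Formula.realize_not, hg.realize_existsInf, Set.not_infinite] at this

end IsGeometric

end Geometric

/-! ### The real structure is geometric -/

section RealGeometric

variable {L : FirstOrder.Language.{u, v}} [L.Structure ℝ] {α : Type}

theorem RealDef.of_formula (φ : L.Formula α) : RealDef L φ.Realize :=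
  ⟨(L.lhomWithConstants _).onFormula φ, fun v => by simp⟩

theorem RealDef₁.sol (φ : L.Formula (α ⊕ Fin 1)) : RealDef₁ L (fun a x => x ∈ sol φ a) := by
  refine (RealDef.of_formula φ).congr fun w => iff_of_eq ?_
  change _ = φ.Realize _
  congr 1
  funext i
  rcases i with i | i
  · rfl
  · rw [Subsingleton.elim i 0]; rfl

/-- O-minimal expansions of the ordered group of reals are geometric. -/
theorem IsOMinimal.isGeometric (ι : oaddLang →ᴸ L) [ι.IsExpansionOn ℝ] (homin : IsOMinimal L ℝ) :
    IsGeometric L ℝ := by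
  have hbound : ∀ {α : Type} [Finite α] (φ : L.Formula (α ⊕ Fin 1)), ∃ l : ℕ, ∀ a : α → ℝ,
      (existsGE l φ).Realize a → (HStr.sol φ a).Infinite := by
    intro α _ φ
    obtain ⟨k, hk⟩ := exists_ncard_bound ι homin (RealDef₁.sol φ)
    refine ⟨k + 1, fun a h hf => ?_⟩
    rw [realize_existsGE_iff_encard, ← hf.cast_ncard_eq] at h
    exact absurd (hk a hf) (not_le.2 (by exact_mod_cast h))
  refine ⟨hbound, fun {α} _ ψ a hfin => ?_⟩
  by_contra hinf
  obtain ⟨l, hl⟩ := hbound (swapVars ψ)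
  have hE : ∀ x, {y | ψ.Realize (Sum.elim (Sum.elim a fun _ => y) fun _ => x)}.Infinite ↔
      x ∈ HStr.sol (existsGE l (swapVars ψ)) a := by
    intro x
    have hs : {y | ψ.Realize (Sum.elim (Sum.elim a fun _ => y) fun _ => x)} =
        HStr.sol (swapVars ψ) (Sum.elim a fun _ => x) := Set.ext fun y => mem_sol_swapVars.symm
    rw [hs]
    exact ⟨fun h => infinite_sol_iff.1 h l, hl _⟩
  simp only [hE] at hinf
  obtain ⟨c, d, hcd, hsub⟩ := homin.exists_Ioo_subset
    (P := fun x => x ∈ HStr.sol (existsGE l (swapVars ψ)) a)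
    ((RealDef₁.sol _).subst (fun i => RealTerm.const (a i)) (RealTerm.var 0)) hinf
  -- For each `x` in the interval the infinite set of `y` contains a rational `q`, so countably many
  -- finite sets would cover an interval.
  refine not_countable_Ioo hcd ((Set.countable_iUnion fun q : ℚ => (hfin q).countable).mono ?_)
  intro x hx
  obtain ⟨c', d', hcd', hsub'⟩ := homin.exists_Ioo_subset
    (P := fun y => y ∈ HStr.sol (swapVars ψ) (Sum.elim a fun _ => x))
    ((RealDef₁.sol _).subst (fun i => RealTerm.const (Sum.elim a (fun _ => x) i))
      (RealTerm.var 0)) (hl _ (hsub x hx.1 hx.2))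
  obtain ⟨q, hq, hq'⟩ := exists_rat_btwn hcd'
  exact Set.mem_iUnion.2 ⟨q, mem_sol_swapVars.1 (hsub' q hq hq')⟩

end RealGeometric

/-! ### H-structures -/

section HSet

variable (L : FirstOrder.Language.{u, v}) {M : Type w} [L.Structure M]

/-- Independence, density and extension for a subset `H` of an `L`-structure. -/
structure IsHSet (H : Set M) : Prop where
  indep : ∀ h ∈ H, h ∉ acl L (H \ {h})
  dens : ∀ {α : Type} [Finite α] (φ : L.Formula (α ⊕ Fin 1)) (a : α → M),
    (sol φ a).Infinite → ∃ h ∈ H, h ∈ sol φ a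
  ext : ∀ {α β : Type} [Finite α] [Finite β] (φ : L.Formula (α ⊕ Fin 1))
    (ψ : L.Formula ((α ⊕ β) ⊕ Fin 1)) (a : α → M), (sol φ a).Infinite →
    (∀ y : β → M, (sol ψ (Sum.elim a y)).Finite) →
    ∃ x ∈ sol φ a, ∀ y : β → M, (∀ j, y j ∈ H) → x ∉ sol ψ (Sum.elim a y)

/-- The predicate symbol `H`. -/
def hSym : (withH L).Relations 1 := (LHom.sumInr : predLang →ᴸ withH L).onRelation (n := 1) PredRel.H

/-- The set named by the predicate `H`. -/
def predSet (M : Type w) [(withH L).Structure M] : Set M :=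
  {x | Structure.RelMap (hSym L) ![x]}

variable {L} {α β : Type}

theorem realize_inH {M : Type w} [(withH L).Structure M] {v : α → M} {x : α} :
    (inH x : (withH L).Formula α).Realize v ↔ v x ∈ predSet L M :=
  Formula.realize_rel₁ (R := hSym L) (t := Term.var x)

theorem realize_up [(withH L).Structure M] [(LHom.sumInl : L →ᴸ withH L).IsExpansionOn M]
    {φ : L.Formula α} {v : α → M} : (up φ).Realize v ↔ φ.Realize v :=
  LHom.realize_onFormula _ _

theorem realize_univClosure {L' : FirstOrder.Language.{u, v}} {M : Type w} [L'.Structure M] {n : ℕ}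
    {φ : L'.Formula (Fin n)} : M ⊨ univClosure φ ↔ ∀ a : Fin n → M, φ.Realize a := by
  rw [univClosure, Sentence.Realize, Formula.realize_iAlls]
  simp only [Formula.realize_relabel]
  exact Iff.rfl

section Axioms

variable [(withH L).Structure M] [(LHom.sumInl : L →ᴸ withH L).IsExpansionOn M]

theorem forall_fin_one {p : (Fin 1 → M) → Prop} : (∀ x, p x) ↔ ∀ x : M, p fun _ => x :=
  ⟨fun h x => h _, fun h x => by
    have := h (x 0)
    rwa [show (fun _ => x 0) = x from  funext fun i => by rw [Subsingleton.elim i 0] ] at this⟩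

theorem exists_fin_one {p : (Fin 1 → M) → Prop} : (∃ x, p x) ↔ ∃ x : M, p fun _ => x :=
  ⟨fun ⟨x, h⟩ => ⟨x 0, by
    rwa [show (fun _ => x 0) = x from  funext fun i => by rw [Subsingleton.elim i 0] ]⟩,
    fun ⟨x, h⟩ => ⟨_, h⟩⟩

theorem realize_independenceAxiom {n k : ℕ} {ψ : L.Formula (Fin n ⊕ Fin 1)} :
    M ⊨ independenceAxiom k ψ ↔ ∀ a : Fin n → M, (∀ i, a i ∈ predSet L M) → ∀ x ∈ predSet L M,
      (∀ i, x ≠ a i) → ¬ (existsGE k ψ).Realize a → x ∉ sol ψ a := by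
  rw [independenceAxiom, realize_univClosure]
  simp only [Formula.realize_imp, Formula.realize_iInf, realize_inH, Formula.realize_iAlls,
    forall_fin_one, Formula.realize_inf, Formula.realize_not, Formula.realize_equal,
    Term.realize_var, realize_up, Formula.realize_relabel, Sum.elim_inl, Sum.elim_inr, existsLT,
    and_imp, ne_eq, mem_sol]
  rfl

theorem realize_densityAxiom {n l : ℕ} {φ : L.Formula (Fin n ⊕ Fin 1)} :
    M ⊨ densityAxiom l φ ↔ ∀ a : Fin n → M, (existsGE l φ).Realize a →
      ∃ h ∈ predSet L M, h ∈ sol φ a := by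
  rw [densityAxiom, realize_univClosure]
  simp only [Formula.realize_imp, realize_inH, Formula.realize_iExs, exists_fin_one,
    Formula.realize_inf, realize_up, Sum.elim_inr, mem_sol]

theorem realize_extensionAxiom {n m k l : ℕ} {φ : L.Formula (Fin n ⊕ Fin 1)}
    {ψ : L.Formula ((Fin n ⊕ Fin m) ⊕ Fin 1)} :
    M ⊨ extensionAxiom k l φ ψ ↔ ∀ a : Fin n → M,
      (∀ y : Fin m → M, ¬ (existsGE k ψ).Realize (Sum.elim a y)) → (existsGE l φ).Realize a →
      ∃ x ∈ sol φ a, ∀ y : Fin m → M, (∀ j, y j ∈ predSet L M) → x ∉ sol ψ (Sum.elim a y) := by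
  rw [extensionAxiom, realize_univClosure]
  simp only [Formula.realize_imp, realize_inH, Formula.realize_iExs, exists_fin_one,
    Formula.realize_inf, realize_up, Sum.elim_inr, mem_sol, Formula.realize_iAlls,
    Formula.realize_iInf, existsLT, Formula.realize_not, Formula.realize_relabel, and_imp]
  have : ∀ (a : Fin n → M) (x : M) (y : Fin m → M),
      (fun i => Sum.elim (Sum.elim a fun _ : Fin 1 => x) y i) ∘ Sum.elim (Sum.elim (Sum.inl ∘ Sum.inl) Sum.inr)
        (Sum.inl ∘ Sum.inr) = Sum.elim (Sum.elim a y) (fun _ : Fin 1 => x) := by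
    intro a x y
    funext i
    rcases i with (i | i) | i <;> rfl
  simp only [this]

end Axioms

variable {R : Type w'} [L.Structure R]

/-- Elimination of `∃^∞` lets the axiom schemes, with their numerical bounds, be replaced by plain
statements about finite and infinite solution sets. -/
theorem models_indepTheory_iff (hg : IsGeometric L R) [(withH L).Structure M]
    [(LHom.sumInl : L →ᴸ withH L).IsExpansionOn M] [Nonempty M] :
    M ⊨ indepTheory (L.completeTheory R) ↔
      M ⊨ L.completeTheory R ∧ IsHSet L (predSet L M) := by
  constructor
  · intro h
    have h' : ∀ σ ∈ indepTheory (L.completeTheory R), M ⊨ σ := h.realize_of_mem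
    have hT : M ⊨ L.completeTheory R :=
      (LHom.onTheory_model (LHom.sumInl : L →ᴸ withH L) _).1
        ⟨fun σ hσ => h' σ (Or.inl (Or.inl (Or.inl hσ)))⟩
    refine ⟨hT, ⟨fun h hH hacl => ?_, fun {α} _ φ a hinf => ?_, fun {α β} _ _ φ ψ a hinf hfin => ?_⟩⟩
    · obtain ⟨α, _, ψ, a, ha, hmem, hfin⟩ := hacl
      let e := Finite.equivFin α
      have hs : sol (ψ.relabel (Sum.map e id)) (a ∘ e.symm) = sol ψ a := by
        rw [sol_relabel, Function.comp_assoc, e.symm_comp_self, Function.comp_id]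
      rw [← hs] at hfin hmem
      obtain ⟨k, hk⟩ := exists_not_realize_existsGE hfin
      have := realize_independenceAxiom.1
        (h' (independenceAxiom k (ψ.relabel (Sum.map e id)))
          (Or.inl (Or.inl (Or.inr ⟨_, k, _, rfl⟩)))) (a ∘ e.symm) (fun i => (ha _).1) h hH
        (fun i hi => (ha (e.symm i)).2 hi.symm) hk
      exact this hmem
    · let e := Finite.equivFin α
      have hs : sol (φ.relabel (Sum.map e id)) (a ∘ e.symm) = sol φ a := by
        rw [sol_relabel, Function.comp_assoc, e.symm_comp_self, Function.comp_id]
      rw [← hs] at hinf ⊢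
      exact realize_densityAxiom.1 (h' (densityAxiom (hg.infBound _) (φ.relabel (Sum.map e id)))
        (Or.inl (Or.inr ⟨_, _, _, hg.expressesInf _, rfl⟩))) _ (infinite_sol_iff.1 hinf _)
    · let e := Finite.equivFin α
      let e' := Finite.equivFin β
      have hs : sol (φ.relabel (Sum.map e id)) (a ∘ e.symm) = sol φ a := by
        rw [sol_relabel, Function.comp_assoc, e.symm_comp_self, Function.comp_id]
      have hs' : ∀ y : β → M, sol (ψ.relabel (Sum.map (Sum.map e e') id))
          (Sum.elim (a ∘ e.symm) (y ∘ e'.symm)) = sol ψ (Sum.elim a y) := by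
        intro y
        rw [sol_relabel, Sum.elim_comp_map, Function.comp_assoc, Function.comp_assoc,
          e.symm_comp_self, e'.symm_comp_self, Function.comp_id, Function.comp_id]
      have hy : ∀ y : Fin (Nat.card β) → M, y = (y ∘ e') ∘ e'.symm := fun y => by
        rw [Function.comp_assoc, e'.self_comp_symm, Function.comp_id]
      rw [← hs] at hinf ⊢
      -- The axiom needs one `k` for all `y`; `infBound` supplies it, since finite fibres have fewer
      -- solutions than that.
      obtain ⟨x, hx, hxy⟩ := realize_extensionAxiom.1
        (h' (extensionAxiom (hg.infBound (ψ.relabel (Sum.map (Sum.map e e') id))) (hg.infBound _)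
          (φ.relabel (Sum.map e id)) (ψ.relabel (Sum.map (Sum.map e e') id)))
          (Or.inr ⟨_, _, _, _, _, _, hg.expressesInf _, rfl⟩)) (a ∘ e.symm)
        (fun y hc => by
          have := hg.realize_existsInf.1 hc
          rw [hy y, hs'] at this
          exact this (hfin _)) (infinite_sol_iff.1 hinf _)
      refine ⟨x, hx, fun y hyH => ?_⟩
      rw [← hs']
      exact hxy _ fun j => hyH _
  · rintro ⟨hT, hH⟩
    have hinf : ∀ {n l : ℕ} {φ : L.Formula (Fin n ⊕ Fin 1)} {a : Fin n → M},
        ExpressesInf (L.completeTheory R) l φ → (existsGE l φ).Realize a → (sol φ a).Infinite :=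
      fun hl ha => infinite_sol_iff.2 fun m =>
        Formula.realize_imp.1 ((hl m).realize_formula M) ha
    refine ⟨fun σ hσ => ?_⟩
    rcases hσ with ((hσ | ⟨n, k, ψ, rfl⟩) | ⟨n, l, φ, hl, rfl⟩) | ⟨n, m, k, l, φ, ψ, hl, rfl⟩
    · exact ((LHom.onTheory_model (LHom.sumInl : L →ᴸ withH L) _).2 hT).realize_of_mem σ hσ
    · rw [realize_independenceAxiom]
      intro a ha x hx hne hk hmem
      exact hH.indep x hx ⟨Fin n, inferInstance, ψ, a,
        fun i => ⟨ha i, fun e => hne i (Set.mem_singleton_iff.1 e).symm⟩, hmem,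
        finite_sol_of_not_realize_existsGE hk⟩
    · rw [realize_densityAxiom]
      exact fun a ha => hH.dens φ a (hinf hl ha)
    · rw [realize_extensionAxiom]
      exact fun a hy ha => hH.ext φ ψ a (hinf hl ha) fun y =>
        finite_sol_of_not_realize_existsGE (hy y)

end HSet

/-! ### Elementary extensions realizing types -/

/-- An ultrapower over the finite subsets `s` of `κ`, along an ultrafilter refining `atTop`: the
class of a choice `d s` realizing `s` satisfies each `Γ i`, because almost all `s` contain `i`. -/
theorem exists_elementaryExtension {L : FirstOrder.Language.{u, v}} (N : Type w) [L.Structure N]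
    [Nonempty N] {α : Type} (b : α → N) {κ : Type k} (Γ : κ → L.Formula (α ⊕ Fin 1))
    (h : ∀ s : Finset κ, ∃ d : N, ∀ i ∈ s, d ∈ sol (Γ i) b) :
    ∃ (N' : Type (max k w)) (_ : L.Structure N') (j : N ↪ₑ[L] N') (d : N'),
      ∀ i, d ∈ sol (Γ i) (j ∘ b) := by
  classical
  let U : Ultrafilter (Finset κ) := Ultrafilter.of Filter.atTop
  let c : N → (U : Filter (Finset κ)).Product (fun _ => N) := fun x => ((fun _ => x : Finset κ → N) :)
  choose d hd using h
  let dU : (U : Filter (Finset κ)).Product (fun _ => N) := (d :)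
  refine ⟨(U : Filter (Finset κ)).Product (fun _ => N), inferInstance, ⟨c, fun n φ x => ?_⟩,
    dU, fun i => ?_⟩
  · change (φ.Realize fun i => c (x i)) ↔ _
    have := Ultraproduct.realize_formula_cast (u := U) φ (fun i (_ : Finset κ) => x i)
    rwa [Filter.eventually_const] at this
  · have := (Ultraproduct.realize_formula_cast (u := U) (Γ i)
      (Sum.elim (fun i (_ : Finset κ) => b i) (fun _ => d))).2 ?_
    · have he : (Sum.elim (fun i => c (b i)) fun _ : Fin 1 => dU) =
          fun i => ((Sum.elim (fun i (_ : Finset κ) => b i) (fun _ => d) i : Finset κ → N) :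
            (U : Filter (Finset κ)).Product (fun _ => N)) := by
        funext i
        rcases i with i | i <;> rfl
      change (Γ i).Realize (Sum.elim (fun i => c (b i)) fun _ : Fin 1 => dU)
      rw [he]
      exact this
    · have hle : (U : Filter (Finset κ)) ≤ Filter.atTop := Ultrafilter.of_le _
      filter_upwards [hle (Filter.eventually_ge_atTop {i})] with s hs
      have := hd s i (hs (Finset.mem_singleton_self i))
      rw [mem_sol] at this
      convert this using 1
      funext i
      rcases i with i | i <;> rfl

/-! ### Tuples independent from `H`, and their behaviour in extensions -/

section BackAndForth

variable {L : FirstOrder.Language.{u, v}} {M : Type w} [L.Structure M] {α β : Type}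

theorem mem_acl_range_union {b : α → M} {S : Set M} {c : M} (hc : c ∈ acl L (Set.range b ∪ S)) :
    ∃ (m : ℕ) (ψ : L.Formula ((α ⊕ Fin m) ⊕ Fin 1)) (y : Fin m → M), (∀ j, y j ∈ S) ∧
      c ∈ sol ψ (Sum.elim b y) ∧ (sol ψ (Sum.elim b y)).Finite := by
  classical
  obtain ⟨β, _, ψ, a, ha, hc, hfin⟩ := hc
  let e := Finite.equivFin {i // a i ∉ Set.range b}
  have hr : ∀ i, a i ∈ Set.range b → ∃ r, b r = a i := fun i hi => hi
  choose r hr using hr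
  let ρ : β → α ⊕ Fin (Nat.card {i // a i ∉ Set.range b}) := fun i =>
    if h : a i ∈ Set.range b then Sum.inl (r i h) else Sum.inr (e ⟨i, h⟩)
  have hρ : Sum.elim b (fun j => a (e.symm j)) ∘ ρ = a := by
    funext i
    by_cases h : a i ∈ Set.range b
    · simp only [Function.comp, ρ, h, dite_true, Sum.elim_inl, hr]
    · simp only [Function.comp, ρ, h, dite_false, Sum.elim_inr, e.symm_apply_apply]
  refine ⟨_, ψ.relabel (Sum.map ρ id), fun j => a (e.symm j),
    fun j => (ha _).resolve_left (e.symm j).2, ?_, ?_⟩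
  · rwa [sol_relabel, hρ]
  · rwa [sol_relabel, hρ]

theorem mem_acl_range_union_of_mem_sol [Finite α] {m : ℕ} {b : α → M} {S : Set M} {c : M}
    {ψ : L.Formula ((α ⊕ Fin m) ⊕ Fin 1)} {y : Fin m → M} (hy : ∀ j, y j ∈ S)
    (hc : c ∈ sol ψ (Sum.elim b y)) (hfin : (sol ψ (Sum.elim b y)).Finite) :
    c ∈ acl L (Set.range b ∪ S) := by
  refine ⟨_, inferInstance, ψ, Sum.elim b y, ?_, hc, hfin⟩
  rintro (i | j)
  · exact Or.inl ⟨i, rfl⟩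
  · exact Or.inr (hy j)

/-- The tuple `a` is independent from `H` over the part of `a` in `H`. -/
def HIndependent (L : FirstOrder.Language.{u, v}) {M : Type w} [L.Structure M] (H : Set M)
    (a : α → M) : Prop :=
  ∀ h ∈ H, h ∉ Set.range a → h ∉ acl L (Set.range a ∪ (H \ {h}))

theorem range_elim_const {a : α → M} {c : M} :
    Set.range (Sum.elim a fun _ : Fin 1 => c) = insert c (Set.range a) := by
  rw [Set.Sum.elim_range, Set.range_const, Set.union_singleton]

variable {R : Type w'} [L.Structure R]

/-- If `c ∈ H`, it was already available in `H \ {x}`. If `c` is not algebraic over `a` and `H`, a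
dependence of `x` using `c` would contradict this by exchange. If `c` is algebraic over `a`, the
closure does not grow. -/
theorem HIndependent.extend (hg : IsGeometric L R) [M ⊨ L.completeTheory R] {H : Set M}
    {a : α → M} (h : HIndependent L H a) {c : M}
    (hc : c ∈ H ∨ c ∉ acl L (Set.range a ∪ H) ∨ c ∈ acl L (Set.range a)) :
    HIndependent L H (Sum.elim a fun _ : Fin 1 => c) := by
  intro x hx hxa hxacl
  rw [range_elim_const] at hxa hxacl
  rw [Set.mem_insert_iff, not_or] at hxa
  have hx' := h x hx hxa.2
  rw [Set.insert_union] at hxacl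
  rcases hc with hc | hc | hc
  · have hcm : c ∈ Set.range a ∪ H \ {x} := Or.inr ⟨hc, fun e => hxa.1 e.symm⟩
    rw [Set.insert_eq_of_mem hcm] at hxacl
    exact hx' hxacl
  · refine hc (acl_mono ?_ (hg.acl_exchange hxacl hx'))
    rintro z (rfl | hz | hz)
    · exact Or.inr hx
    · exact Or.inl hz
    · exact Or.inr hz.1
  · refine hx' (acl_subset_of_subset_acl (Set.insert_subset ?_ (subset_acl _)) hxacl)
    exact acl_mono Set.subset_union_left hc

theorem mem_predSet_elementary {M : Type w} [(withH L).Structure M] {N : Type k}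
    [(withH L).Structure N] (j : M ↪ₑ[withH L] N) {x : M} :
    j x ∈ predSet L N ↔ x ∈ predSet L M := by
  have := j.map_formula (inH (0 : Fin 1) : (withH L).Formula (Fin 1)) (fun _ => x)
  rwa [realize_inH, realize_inH] at this

section Extension

variable [(withH L).Structure M] [(LHom.sumInl : L →ᴸ withH L).IsExpansionOn M]
  {N : Type k} [L.Structure N] [(withH L).Structure N]
  [(LHom.sumInl : L →ᴸ withH L).IsExpansionOn N]

theorem realize_comp_elementary (j : M ↪ₑ[withH L] N) (φ : L.Formula α) (v : α → M) :
    φ.Realize (j ∘ v) ↔ φ.Realize v := by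
  rw [← realize_up (M := N), ← realize_up (M := M), j.map_formula]

/-- The formula `(∃ y₁ … yₘ ∈ H) ψ(a, y, x)`, where `ψ` is made algebraic in `x`. -/
noncomputable def algOverH (hg : IsGeometric L R) [Finite α] {m : ℕ}
    (ψ : L.Formula ((α ⊕ Fin m) ⊕ Fin 1)) : (withH L).Formula (α ⊕ Fin 1) :=
  Formula.iExs (Fin m) (Formula.iInf (fun j : Fin m => inH (Sum.inr j)) ⊓
    up ((hg.algPart ψ).relabel
      (Sum.elim (Sum.elim (Sum.inl ∘ Sum.inl) Sum.inr) (Sum.inl ∘ Sum.inr))))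

theorem mem_sol_algOverH (hg : IsGeometric L R) [Finite α] {m : ℕ}
    {ψ : L.Formula ((α ⊕ Fin m) ⊕ Fin 1)} {a : α → M} {x : M} :
    x ∈ sol (algOverH hg ψ) a ↔
      ∃ y : Fin m → M, (∀ j, y j ∈ predSet L M) ∧ x ∈ sol (hg.algPart ψ) (Sum.elim a y) := by
  simp only [mem_sol, algOverH, Formula.realize_iExs, Formula.realize_inf, Formula.realize_iInf,
    realize_inH, realize_up, Formula.realize_relabel, Sum.elim_inr]
  refine exists_congr fun y => and_congr_right fun _ => iff_of_eq ?_
  congr 1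
  funext i
  rcases i with (i | i) | i <;> rfl

theorem mem_acl_union_predSet_iff (hg : IsGeometric L R) [M ⊨ L.completeTheory R] [Finite α]
    {a : α → M} {x : M} : x ∈ acl L (Set.range a ∪ predSet L M) ↔
      ∃ (m : ℕ) (ψ : L.Formula ((α ⊕ Fin m) ⊕ Fin 1)), x ∈ sol (algOverH hg ψ) a := by
  constructor
  · intro h
    obtain ⟨m, ψ, y, hy, hx, hfin⟩ := mem_acl_range_union h
    refine ⟨m, ψ, (mem_sol_algOverH hg).2 ⟨y, hy, ?_⟩⟩
    rw [hg.sol_algPart]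
    exact ⟨hx, hfin⟩
  · rintro ⟨m, ψ, h⟩
    obtain ⟨y, hy, hx⟩ := (mem_sol_algOverH hg).1 h
    exact mem_acl_range_union_of_mem_sol hy hx (hg.finite_sol_algPart _ _)

/-- In an H-structure, types that avoid the algebraic closure of `H` are finitely satisfiable. -/
theorem exists_mem_sol_forall_notMem (hg : IsGeometric L R) [M ⊨ L.completeTheory R] [Finite α]
    (hH : IsHSet L (predSet L M)) {φ : L.Formula (α ⊕ Fin 1)} {a : α → M}
    (hinf : (sol φ a).Infinite) (s : Finset (Σ m : ℕ, L.Formula ((α ⊕ Fin m) ⊕ Fin 1))) :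
    ∃ x ∈ sol φ a, ∀ p ∈ s, x ∉ sol (algOverH hg p.2) a := by
  classical
  obtain ⟨h₀, hh₀, -⟩ := hH.dens φ a hinf
  let q : Fin s.card → Σ m : ℕ, L.Formula ((α ⊕ Fin m) ⊕ Fin 1) := fun i => (s.equivFin.symm i).1
  -- One extension axiom handles all of `s`: take the disjunction, with separate variables from `H`
  -- for each disjunct.
  let χ : L.Formula ((α ⊕ (Σ i, Fin (q i).1)) ⊕ Fin 1) :=
    Formula.iSup fun i => (hg.algPart (q i).2).relabel (Sum.map (Sum.map id fun l => ⟨i, l⟩) id)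
  have hχ : ∀ (y : (Σ i, Fin (q i).1) → M) (x : M), x ∈ sol χ (Sum.elim a y) ↔
      ∃ i, x ∈ sol (hg.algPart (q i).2) (Sum.elim a fun l => y ⟨i, l⟩) := by
    intro y x
    rw [mem_sol, Formula.realize_iSup]
    refine exists_congr fun i => ?_
    rw [← mem_sol, mem_sol_relabel, Sum.elim_comp_map]
    rfl
  obtain ⟨x, hx, hxy⟩ := hH.ext φ χ a hinf fun y => by
    refine (Set.finite_iUnion fun i =>
      hg.finite_sol_algPart (q i).2 (Sum.elim a fun l => y ⟨i, l⟩)).subset fun x hx => ?_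
    exact Set.mem_iUnion.2 ((hχ y x).1 hx)
  refine ⟨x, hx, fun p hp hxp => ?_⟩
  obtain ⟨i, rfl⟩ : ∃ i, q i = p := ⟨s.equivFin ⟨p, hp⟩, by simp [q]⟩
  obtain ⟨y, hy, hxy'⟩ := (mem_sol_algOverH hg).1 hxp
  let f : Fin (q i).1 → Σ i, Fin (q i).1 := fun l => ⟨i, l⟩
  have hf : Function.Injective f := sigma_mk_injective (β := fun i => Fin (q i).1)
  -- The variables of the other disjuncts must also lie in `H`; the element `h₀` fills them.
  refine hxy (Function.extend f y fun _ => h₀) (fun l => ?_) ((hχ _ _).2 ⟨i, ?_⟩)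
  · by_cases hl : ∃ j, f j = l
    · obtain ⟨j, rfl⟩ := hl
      rw [hf.extend_apply]; exact hy j
    · rw [Function.extend_apply' _ _ _ hl]; exact hh₀
  · have : (fun l => Function.extend f y (fun _ => h₀) ⟨i, l⟩) = y :=
      funext fun l => hf.extend_apply y _ l
    rwa [this]

/-- The formula expressing that `x ∈ H` is not among the entries of `a` and satisfies `ψ(a, y, x)`,
with `ψ` made algebraic in `x`, for some `y` from `H \ {x}`. -/
noncomputable def dependence (hg : IsGeometric L R) [Finite α] {m : ℕ}
    (ψ : L.Formula ((α ⊕ Fin m) ⊕ Fin 1)) : (withH L).Formula (α ⊕ (Fin m ⊕ Fin 1)) :=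
  Formula.iInf (fun i : Fin m => inH (Sum.inr (Sum.inl i)) ⊓
    ∼(Term.equal (Term.var (Sum.inr (Sum.inl i))) (Term.var (Sum.inr (Sum.inr 0))))) ⊓
  (inH (Sum.inr (Sum.inr 0)) ⊓
  (Formula.iInf (fun i : α =>
    ∼(Term.equal (Term.var (Sum.inr (Sum.inr 0))) (Term.var (Sum.inl i)))) ⊓
  up ((hg.algPart ψ).relabel (Sum.elim (Sum.map id Sum.inl) (Sum.inr ∘ Sum.inr)))))

theorem realize_dependence (hg : IsGeometric L R) [Finite α] {m : ℕ}
    {ψ : L.Formula ((α ⊕ Fin m) ⊕ Fin 1)} {a : α → M} {w : Fin m ⊕ Fin 1 → M} :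
    (dependence hg ψ).Realize (Sum.elim a w) ↔
      (∀ i, w (Sum.inl i) ∈ predSet L M ∧ w (Sum.inl i) ≠ w (Sum.inr 0)) ∧
      w (Sum.inr 0) ∈ predSet L M ∧ (∀ i, w (Sum.inr 0) ≠ a i) ∧
      w (Sum.inr 0) ∈ sol (hg.algPart ψ) (Sum.elim a (w ∘ Sum.inl)) := by
  have : Sum.elim a w ∘ Sum.elim (Sum.map id Sum.inl) (Sum.inr ∘ Sum.inr) =
      Sum.elim (Sum.elim a (w ∘ Sum.inl)) fun _ : Fin 1 => w (Sum.inr 0) := by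
    funext i
    rcases i with (i | i) | i
    · rfl
    · rfl
    · rw [Subsingleton.elim i 0]; rfl
  simp only [dependence, Formula.realize_inf, Formula.realize_iInf, realize_inH,
    Formula.realize_not, Formula.realize_equal, Term.realize_var, Sum.elim_inl, Sum.elim_inr,
    realize_up, Formula.realize_relabel, mem_sol, this, ne_eq]

/-- A failure of independence is witnessed by a single existential `L ∪ {H}`-formula about the
tuple, so a failure in `N` would already occur in `M`. -/
theorem HIndependent.map (hg : IsGeometric L R) [M ⊨ L.completeTheory R]
    [N ⊨ L.completeTheory R] [Finite α] (j : M ↪ₑ[withH L] N) {a : α → M}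
    (h : HIndependent L (predSet L M) a) : HIndependent L (predSet L N) (j ∘ a) := by
  intro x hx hxa hxacl
  obtain ⟨m, ψ, y, hy, hxs, hfin⟩ := mem_acl_range_union hxacl
  have h1 : (Formula.iExs _ (dependence hg ψ)).Realize (j ∘ a) := by
    rw [Formula.realize_iExs]
    refine ⟨Sum.elim y fun _ => x, (realize_dependence hg).2
      ⟨hy, hx, fun i e => hxa ⟨i, e.symm⟩, ?_⟩⟩
    rw [hg.sol_algPart]
    exact ⟨hxs, hfin⟩
  rw [j.map_formula, Formula.realize_iExs] at h1
  obtain ⟨w, hw⟩ := h1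
  obtain ⟨hw1, hw2, hw3, hw4⟩ := (realize_dependence hg).1 hw
  exact h _ hw2 (fun ⟨i, e⟩ => hw3 i e.symm)
    (mem_acl_range_union_of_mem_sol hw1 hw4 (hg.finite_sol_algPart _ _))

end Extension
end BackAndForth

/-! ### Similar tuples and one-point extensions -/

section Completeness

variable {L : FirstOrder.Language.{u, v}} {α : Type}

/-- Two tuples, independent from `H` over their parts in `H`, that have the same `L`-type and the
same entries in `H`. -/
structure Similar (L : FirstOrder.Language.{u, v}) {M : Type w} [L.Structure M] {N : Type k}
    [L.Structure N] (H : Set M) (K : Set N) (a : α → M) (b : α → N) : Prop where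
  realize_iff : ∀ φ : L.Formula α, φ.Realize a ↔ φ.Realize b
  mem_iff : ∀ i, a i ∈ H ↔ b i ∈ K
  left : HIndependent L H a
  right : HIndependent L K b

theorem Similar.symm {M : Type w} [L.Structure M] {N : Type k} [L.Structure N] {H : Set M}
    {K : Set N} {a : α → M} {b : α → N} (h : Similar L H K a b) : Similar L K H b a :=
  ⟨fun φ => (h.realize_iff φ).symm, fun i => (h.mem_iff i).symm, h.right, h.left⟩

theorem sol_infinite_of_not_mem_acl {M : Type w} [L.Structure M] [Finite α] {a : α → M} {c : M}
    (hc : c ∉ acl L (Set.range a)) {φ : L.Formula (α ⊕ Fin 1)} (h : c ∈ sol φ a) :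
    (sol φ a).Infinite := fun hfin =>
  hc ⟨α, inferInstance, φ, a, fun i => ⟨i, rfl⟩, h, hfin⟩

theorem mem_acl_range {M : Type w} [L.Structure M] {a : α → M} {c : M}
    (hc : c ∈ acl L (Set.range a)) : ∃ φ : L.Formula (α ⊕ Fin 1), c ∈ sol φ a ∧
      (sol φ a).Finite := by
  obtain ⟨β, _, ψ, d, hd, hc, hfin⟩ := hc
  choose r hr using hd
  obtain rfl : a ∘ r = d := funext hr
  exact ⟨ψ.relabel (Sum.map r id), by rwa [sol_relabel], by rwa [sol_relabel]⟩

section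

variable {R : Type w'} [L.Structure R] {M : Type w} [L.Structure M] {N : Type k} [L.Structure N]

theorem Similar.sol_infinite (hg : IsGeometric L R) [M ⊨ L.completeTheory R]
    [N ⊨ L.completeTheory R] [Finite α] {H : Set M} {K : Set N} {a : α → M} {b : α → N}
    (h : Similar L H K a b) {φ : L.Formula (α ⊕ Fin 1)} (hφ : (sol φ a).Infinite) :
    (sol φ b).Infinite := by
  rw [← hg.realize_existsInf] at hφ ⊢
  rwa [← h.realize_iff]

theorem Similar.exists_mem_sol [Finite α] {H : Set M} {K : Set N} {a : α → M} {b : α → N}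
    (h : Similar L H K a b) {φ : L.Formula (α ⊕ Fin 1)} {c : M} (hc : c ∈ sol φ a) :
    ∃ d, d ∈ sol φ b := by
  have := (h.realize_iff (φ.iExs (Fin 1))).1 (Formula.realize_iExs.2 ⟨fun _ => c, hc⟩)
  obtain ⟨d, hd⟩ := Formula.realize_iExs.1 this
  refine ⟨d 0, ?_⟩
  rw [mem_sol]
  rwa [show (fun _ => d 0) = d from funext fun i => by rw [Subsingleton.elim i 0] ]

variable [(withH L).Structure N] [(LHom.sumInl : L →ᴸ withH L).IsExpansionOn N]

/-- If the `L`-type of `c` over `a`, together with further conditions, is finitely satisfiable over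
`b`, then it is realized in an elementary extension. -/
theorem exists_realizing_extension [Nonempty N] {a : α → M} {b : α → N} {c : M} {κ : Type (max u v)}
    (Γ : κ → (withH L).Formula (α ⊕ Fin 1))
    (h : ∀ φ : L.Formula (α ⊕ Fin 1), c ∈ sol φ a → ∀ s : Finset κ,
      ∃ d ∈ sol φ b, ∀ i ∈ s, d ∈ sol (Γ i) b) :
    ∃ (N' : Type (max u v k)) (_ : L.Structure N') (_ : (withH L).Structure N')
      (_ : (LHom.sumInl : L →ᴸ withH L).IsExpansionOn N') (j : N ↪ₑ[withH L] N') (d : N'),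
      (∀ φ : L.Formula (α ⊕ Fin 1), φ.Realize (Sum.elim a fun _ => c) ↔
        φ.Realize (Sum.elim (j ∘ b) fun _ => d)) ∧ ∀ i, d ∈ sol (Γ i) (j ∘ b) := by
  classical
  obtain ⟨N', inst, j, d, hd⟩ := exists_elementaryExtension N b
    (Sum.elim (fun φ : {φ : L.Formula (α ⊕ Fin 1) // c ∈ sol φ a} => up φ.1) Γ) (by
      intro s
      obtain ⟨d, hd, hd'⟩ := h (Formula.iInf fun φ : s.toLeft => φ.1.1)
        ((Formula.realize_iInf).2 fun φ => φ.1.2) s.toRight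
      refine ⟨d, ?_⟩
      rintro (φ | i) hi
      · exact realize_up.2 (Formula.realize_iInf.1 hd ⟨φ, Finset.mem_toLeft.2 hi⟩)
      · exact hd' i (Finset.mem_toRight.2 hi))
  let _ : L.Structure N' := (LHom.sumInl : L →ᴸ withH L).reduct N'
  have key : ∀ φ : L.Formula (α ⊕ Fin 1), φ.Realize (Sum.elim a fun _ => c) →
      φ.Realize (Sum.elim (j ∘ b) fun _ => d) := fun φ hφ =>
    realize_up.1 (hd (Sum.inl ⟨φ, hφ⟩))
  refine ⟨N', inferInstance, inst, inferInstance, j, d, fun φ => ⟨key φ, fun hφ => ?_⟩,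
    fun i => hd (Sum.inr i)⟩
  by_contra hc
  exact key φ.not hc hφ

variable [(withH L).Structure M]

/-- If `c` is algebraic over `a`, the `L`-type decides membership in `H`: by independence the only
elements of `H` algebraic over the tuple are its entries. Otherwise every formula in the type of `c`
has infinitely many solutions over `b`. Density then makes the type together with `H(x)` finitely
satisfiable; extension does the same for the type together with non-algebraicity over `b` and the
predicate. -/
theorem Similar.exists_extend (hg : IsGeometric L R) [Nonempty N] [M ⊨ L.completeTheory R]
    (hN : N ⊨ indepTheory (L.completeTheory R)) [Finite α] {a : α → M} {b : α → N}
    (h : Similar L (predSet L M) (predSet L N) a b) {c : M}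
    (hc : c ∈ predSet L M ∨ c ∉ acl L (Set.range a ∪ predSet L M) ∨ c ∈ acl L (Set.range a)) :
    ∃ (N' : Type (max u v k)) (_ : L.Structure N') (_ : (withH L).Structure N')
      (_ : (LHom.sumInl : L →ᴸ withH L).IsExpansionOn N') (j : N ↪ₑ[withH L] N') (d : N'),
      Similar L (predSet L M) (predSet L N') (Sum.elim a fun _ : Fin 1 => c)
        (Sum.elim (j ∘ b) fun _ => d) := by
  obtain ⟨hT, hK⟩ := (models_indepTheory_iff hg).1 hN
  have hleft := h.left.extend hg hc
  by_cases hacl : c ∈ acl L (Set.range a)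
  · obtain ⟨N', _, _, _, j, d, hd, -⟩ := exists_realizing_extension (N := N) (a := a) (b := b)
      (c := c) (κ := PEmpty) (fun i => i.elim) (fun φ hφ s => by
        obtain ⟨d, hd⟩ := h.exists_mem_sol hφ
        exact ⟨d, hd, fun i => i.elim⟩)
    have : N' ⊨ indepTheory (L.completeTheory R) := (j.theory_model_iff _).1 hN
    have : Nonempty N' := ⟨d⟩
    have := ((models_indepTheory_iff hg).1 ‹N' ⊨ indepTheory (L.completeTheory R)›).1
    have hright : HIndependent L (predSet L N') (j ∘ b) := h.right.map hg j
    have hdacl : d ∈ acl L (Set.range (j ∘ b)) := by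
      obtain ⟨φ, hφ, hfin⟩ := mem_acl_range hacl
      obtain ⟨m, hm⟩ := exists_not_realize_existsGE hfin
      refine ⟨α, inferInstance, φ, j ∘ b, fun i => ⟨i, rfl⟩, (hd φ).1 hφ,
        finite_sol_of_not_realize_existsGE (k := m) ?_⟩
      rwa [realize_comp_elementary, ← h.realize_iff]
    have heq : ∀ i, c = a i ↔ d = j (b i) := fun i => by
      have := hd (Term.equal (Term.var (Sum.inr 0)) (Term.var (Sum.inl i)))
      simpa using this
    refine ⟨N', _, _, ‹_›, j, d, hd, ?_, hleft, hright.extend hg (Or.inr (Or.inr hdacl))⟩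
    rintro (i | i)
    · exact (h.mem_iff i).trans (mem_predSet_elementary j).symm
    · constructor
      · intro hcH
        by_contra hdK
        have hca : c ∉ Set.range a := by
          rintro ⟨l, hl⟩
          apply hdK
          have e := (heq l).1 hl.symm
          simp only [Sum.elim_inr] at hcH ⊢
          rw [e, mem_predSet_elementary, ← h.mem_iff, hl]
          exact hcH
        exact h.left c hcH hca (acl_mono Set.subset_union_left hacl)
      · intro hdK
        by_contra hcH
        have hda : d ∉ Set.range (j ∘ b) := by
          rintro ⟨l, hl⟩
          apply hcH
          have e := (heq l).2 hl.symm
          simp only [Sum.elim_inr] at hdK ⊢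
          rw [e, h.mem_iff, ← mem_predSet_elementary j]
          exact (show j (b l) = d from hl) ▸ hdK
        exact hright d hdK hda (acl_mono Set.subset_union_left hdacl)
  have hinf : ∀ φ : L.Formula (α ⊕ Fin 1), c ∈ sol φ a → (sol φ b).Infinite := fun φ hφ =>
    h.sol_infinite hg (sol_infinite_of_not_mem_acl hacl hφ)
  by_cases hcH : c ∈ predSet L M
  · obtain ⟨N', _, _, _, j, d, hd, hd'⟩ := exists_realizing_extension (N := N) (a := a) (b := b)
      (c := c) (κ := PUnit) (fun _ => inH (Sum.inr 0)) (fun φ hφ s => by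
        obtain ⟨d, hdK, hd⟩ := hK.dens φ b (hinf φ hφ)
        exact ⟨d, hd, fun _ _ => realize_inH.2 hdK⟩)
    have : N' ⊨ indepTheory (L.completeTheory R) := (j.theory_model_iff _).1 hN
    have : Nonempty N' := ⟨d⟩
    have := ((models_indepTheory_iff hg).1 ‹N' ⊨ indepTheory (L.completeTheory R)›).1
    have hdK : d ∈ predSet L N' := realize_inH.1 (hd' PUnit.unit)
    refine ⟨N', _, _, ‹_›, j, d, hd, ?_, hleft, (h.right.map hg j).extend hg (Or.inl hdK)⟩
    rintro (i | i)
    · exact (h.mem_iff i).trans (mem_predSet_elementary j).symm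
    · exact iff_of_true hcH hdK
  · have hcg : c ∉ acl L (Set.range a ∪ predSet L M) := (hc.resolve_left hcH).resolve_right hacl
    obtain ⟨N', _, _, _, j, d, hd, hd'⟩ := exists_realizing_extension (N := N) (a := a) (b := b)
      (c := c) (κ := Σ m : ℕ, L.Formula ((α ⊕ Fin m) ⊕ Fin 1))
      (fun p => (algOverH hg p.2).not) (fun φ hφ s =>
        exists_mem_sol_forall_notMem hg hK (hinf φ hφ) s)
    have : N' ⊨ indepTheory (L.completeTheory R) := (j.theory_model_iff _).1 hN
    have : Nonempty N' := ⟨d⟩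
    have := ((models_indepTheory_iff hg).1 ‹N' ⊨ indepTheory (L.completeTheory R)›).1
    have hdg : d ∉ acl L (Set.range (j ∘ b) ∪ predSet L N') := by
      intro hdacl
      obtain ⟨m, ψ, hψ⟩ := (mem_acl_union_predSet_iff hg).1 hdacl
      exact hd' ⟨m, ψ⟩ hψ
    refine ⟨N', _, _, ‹_›, j, d, hd, ?_, hleft,
      (h.right.map hg j).extend hg (Or.inr (Or.inl hdg))⟩
    rintro (i | i)
    · exact (h.mem_iff i).trans (mem_predSet_elementary j).symm
    · exact iff_of_false hcH fun hdK => hdg (subset_acl _ (Or.inr hdK))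

end

end Completeness

/-! ### Back-and-forth and completeness of the theory of H-structures -/

section Completeness

variable {L : FirstOrder.Language.{u, v}} {R : Type w'} [L.Structure R]

theorem Similar.exists_extend_finite (hg : IsGeometric L R) {M N : Type (max u v w)}
    [L.Structure M] [(withH L).Structure M] [(LHom.sumInl : L →ᴸ withH L).IsExpansionOn M]
    [L.Structure N] [(withH L).Structure N] [(LHom.sumInl : L →ᴸ withH L).IsExpansionOn N]
    [Nonempty N] [M ⊨ L.completeTheory R] (hN : N ⊨ indepTheory (L.completeTheory R))
    {α : Type} [Finite α] {a : α → M} {b : α → N}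
    (h : Similar L (predSet L M) (predSet L N) a b) {s : Set M} (hs : s.Finite)
    (hsH : s ⊆ predSet L M) :
    ∃ (N' : Type (max u v w)) (_ : L.Structure N') (_ : (withH L).Structure N')
      (_ : (LHom.sumInl : L →ᴸ withH L).IsExpansionOn N') (j : N ↪ₑ[withH L] N')
      (α' : Type) (_ : Finite α') (e : α → α') (a' : α' → M) (b' : α' → N'),
      Similar L (predSet L M) (predSet L N') a' b' ∧ a' ∘ e = a ∧ b' ∘ e = j ∘ b ∧
        s ⊆ Set.range a' ∧ Set.range a' ⊆ Set.range a ∪ predSet L M := by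
  induction s, hs using Set.Finite.induction_on with
  | empty =>
    exact ⟨N, _, _, ‹_›, ElementaryEmbedding.refl _ _, α, ‹_›, id, a, b, h, rfl, rfl,
      Set.empty_subset _, Set.subset_union_left⟩
  | @insert c s _ _ ih =>
    obtain ⟨N₁, _, _, _, j₁, α₁, _, e₁, a₁, b₁, h₁, rfl, hb₁, hs₁, hr₁⟩ :=
      ih ((Set.subset_insert _ _).trans hsH)
    have hN₁ : N₁ ⊨ indepTheory (L.completeTheory R) := (j₁.theory_model_iff _).1 hN
    have : Nonempty N₁ := Nonempty.map j₁ inferInstance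
    obtain ⟨N₂, _, _, _, j₂, d, h₂⟩ := h₁.exists_extend hg hN₁ (Or.inl (hsH (Set.mem_insert c s)))
    refine ⟨N₂, _, _, ‹_›, j₂.comp j₁, α₁ ⊕ Fin 1, inferInstance, Sum.inl ∘ e₁, _, _, h₂,
      ?_, ?_, ?_, ?_⟩
    · rw [← Function.comp_assoc, Sum.elim_comp_inl]
    · rw [← Function.comp_assoc, Sum.elim_comp_inl, Function.comp_assoc, hb₁]
      rfl
    · rw [range_elim_const]
      exact Set.insert_subset_insert hs₁
    · rw [range_elim_const]
      exact Set.insert_subset (Or.inr (hsH (Set.mem_insert c s))) hr₁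

/-- An arbitrary `c` need not fit the cases of `Similar.exists_extend`. If it is algebraic over `a`
and `H`, finitely many elements of `H` suffice; adjoining them first makes `c` algebraic over the
tuple. -/
theorem Similar.forth (hg : IsGeometric L R) {M N : Type (max u v w)}
    [L.Structure M] [(withH L).Structure M] [(LHom.sumInl : L →ᴸ withH L).IsExpansionOn M]
    [L.Structure N] [(withH L).Structure N] [(LHom.sumInl : L →ᴸ withH L).IsExpansionOn N]
    [Nonempty N] [M ⊨ L.completeTheory R] (hN : N ⊨ indepTheory (L.completeTheory R))
    {α : Type} [Finite α] {a : α → M} {b : α → N}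
    (h : Similar L (predSet L M) (predSet L N) a b) (c : M) :
    ∃ (N' : Type (max u v w)) (_ : L.Structure N') (_ : (withH L).Structure N')
      (_ : (LHom.sumInl : L →ᴸ withH L).IsExpansionOn N') (j : N ↪ₑ[withH L] N')
      (α' : Type) (_ : Finite α') (e : α → α') (a' : α' → M) (b' : α' → N'),
      Similar L (predSet L M) (predSet L N') a' b' ∧ a' ∘ e = a ∧ b' ∘ e = j ∘ b ∧
        ∃ i, a' i = c := by
  obtain ⟨s, hs, hsH, hc⟩ : ∃ s : Set M, s.Finite ∧ s ⊆ predSet L M ∧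
      (c ∈ acl L (Set.range a ∪ predSet L M) → c ∈ acl L (Set.range a ∪ s)) := by
    by_cases hc : c ∈ acl L (Set.range a ∪ predSet L M)
    · obtain ⟨A, hA, hAfin, hcA⟩ := acl_finite_character hc
      refine ⟨A ∩ predSet L M, hAfin.subset Set.inter_subset_left, Set.inter_subset_right,
        fun _ => acl_mono (fun x hx => ?_) hcA⟩
      exact (hA hx).imp id fun h => ⟨hx, h⟩
    · exact ⟨∅, Set.finite_empty, Set.empty_subset _, fun h => absurd h hc⟩
  obtain ⟨N₁, _, _, _, j₁, α₁, _, e₁, a₁, b₁, h₁, rfl, hb₁, hs₁, hr₁⟩ :=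
    h.exists_extend_finite hg hN hs hsH
  have hN₁ : N₁ ⊨ indepTheory (L.completeTheory R) := (j₁.theory_model_iff _).1 hN
  have : Nonempty N₁ := Nonempty.map j₁ inferInstance
  have hsub : Set.range (a₁ ∘ e₁) ∪ s ⊆ Set.range a₁ :=
    Set.union_subset (Set.range_comp_subset_range _ _) hs₁
  obtain ⟨N₂, _, _, _, j₂, d, h₂⟩ := h₁.exists_extend (c := c) hg hN₁ (by
    by_cases hc' : c ∈ acl L (Set.range a₁)
    · exact Or.inr (Or.inr hc')
    · refine Or.inr (Or.inl fun h' => hc' ?_)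
      refine acl_mono hsub (hc (acl_mono ?_ h'))
      exact Set.union_subset hr₁ Set.subset_union_right)
  refine ⟨N₂, _, _, ‹_›, j₂.comp j₁, α₁ ⊕ Fin 1, inferInstance, Sum.inl ∘ e₁, _, _, h₂,
    ?_, ?_, Sum.inr 0, rfl⟩
  · rw [← Function.comp_assoc, Sum.elim_comp_inl]
  · rw [← Function.comp_assoc, Sum.elim_comp_inl, Function.comp_assoc, hb₁]
    rfl

theorem exists_onTerm_eq {γ : Type} (t : (withH L).Term γ) :
    ∃ t' : L.Term γ, (LHom.sumInl : L →ᴸ withH L).onTerm t' = t := by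
  induction t with
  | var i => exact ⟨Term.var i, rfl⟩
  | func f ts ih =>
    choose ts' hts using ih
    rcases f with f | f
    · exact ⟨Term.func f ts', congrArg _ (funext hts)⟩
    · exact f.elim

theorem elim_default_comp {M : Type w} {n : ℕ} {α : Type} (a : α → M) (s : Fin n → α) :
    (Sum.elim default (a ∘ s) : Empty ⊕ Fin n → M) = a ∘ Sum.elim Empty.elim s := by
  funext i
  rcases i with i | i
  · exact i.elim
  · rfl

/-- The value of a term is algebraic over the tuple, so by independence it can lie in `H` only by
being an entry, and the `L`-type records which one. -/
theorem Similar.realize_mem_of_realize_mem {M : Type w} [L.Structure M] {N : Type k}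
    [L.Structure N] {H : Set M} {K : Set N} {α : Type} [Finite α] {a : α → M} {b : α → N}
    (h : Similar L H K a b) (t : L.Term α) (ht : t.realize a ∈ H) : t.realize b ∈ K := by
  have hacl : t.realize a ∈ acl L (Set.range a) := by
    refine ⟨α, inferInstance, Term.equal (Term.var (Sum.inr 0)) (t.relabel Sum.inl), a,
      fun i => ⟨i, rfl⟩, ?_, (Set.finite_singleton (t.realize a)).subset fun x hx => ?_⟩
    · simp [mem_sol]
    · simpa [mem_sol] using hx
  obtain ⟨i, hi⟩ : t.realize a ∈ Set.range a := by
    by_contra hc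
    exact h.left _ ht hc (acl_mono Set.subset_union_left hacl)
  have := (h.realize_iff (Term.equal (Term.var i) t)).1 (by simpa using hi)
  have hb : b i = t.realize b := by simpa using this
  rw [← hb, ← h.mem_iff, hi]
  exact ht

/-- Induction on `φ`, with the models universally quantified because the quantifier case passes to
an elementary extension. The map `s` selects the entries used as variables, since the back-and-forth
enlarges tuples by auxiliary elements of `H`. -/
theorem Similar.realize_boundedFormula_iff (hg : IsGeometric L R) {n : ℕ}
    (φ : (withH L).BoundedFormula Empty n) : ∀ {M N : Type (max u v w)}
    [L.Structure M] [(withH L).Structure M] [(LHom.sumInl : L →ᴸ withH L).IsExpansionOn M]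
    [L.Structure N] [(withH L).Structure N] [(LHom.sumInl : L →ᴸ withH L).IsExpansionOn N]
    [Nonempty M] [Nonempty N] (_ : M ⊨ indepTheory (L.completeTheory R))
    (_ : N ⊨ indepTheory (L.completeTheory R))
    {α : Type} [Finite α] {a : α → M} {b : α → N}
    (_ : Similar L (predSet L M) (predSet L N) a b) (s : Fin n → α),
    φ.Realize default (a ∘ s) ↔ φ.Realize default (b ∘ s) := by
  induction φ with
  | falsum => intros; exact Iff.rfl
  | @equal n t₁ t₂ =>
    intro M N _ _ _ _ _ _ _ _ hM hN α _ a b h s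
    obtain ⟨t₁, rfl⟩ := exists_onTerm_eq t₁
    obtain ⟨t₂, rfl⟩ := exists_onTerm_eq t₂
    have := h.realize_iff (Term.equal (t₁.relabel (Sum.elim Empty.elim s))
      (t₂.relabel (Sum.elim Empty.elim s)))
    simpa only [BoundedFormula.Realize, LHom.realize_onTerm, elim_default_comp,
      Formula.realize_equal, Term.realize_relabel] using this
  | @rel n l r ts =>
    intro M N _ _ _ _ _ _ _ _ hM hN α _ a b h s
    choose ts' hts using fun i => exists_onTerm_eq (ts i)
    obtain rfl := funext hts
    rcases r with r | r
    · have := h.realize_iff (Relations.formula r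
        fun i => (ts' i).relabel (Sum.elim Empty.elim s))
      simp only [Formula.realize_rel, Term.realize_relabel, ← elim_default_comp] at this
      simp only [BoundedFormula.Realize, LHom.realize_onTerm]
      rw [show (Sum.inl r : (withH L).Relations l) =
        (LHom.sumInl : L →ᴸ withH L).onRelation r from rfl, LHom.map_onRelation,
        LHom.map_onRelation]
      exact this
    · cases r
      have hx : ∀ {Q : Type (max u v w)} [L.Structure Q] [(withH L).Structure Q]
          [(LHom.sumInl : L →ᴸ withH L).IsExpansionOn Q] (q : α → Q),
          (BoundedFormula.rel (Sum.inr PredRel.H : (withH L).Relations 1) fun i =>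
            (LHom.sumInl : L →ᴸ withH L).onTerm (ts' i)).Realize default (q ∘ s) ↔
          ((ts' 0).relabel (Sum.elim Empty.elim s)).realize q ∈ predSet L Q := by
        intro Q _ _ _ q
        simp only [BoundedFormula.Realize, LHom.realize_onTerm, Term.realize_relabel,
          elim_default_comp]
        refine iff_of_eq (congrArg (Structure.RelMap (hSym L)) (funext fun i => ?_))
        rw [Subsingleton.elim i 0]
        rfl
      rw [hx, hx]
      exact ⟨h.realize_mem_of_realize_mem _, h.symm.realize_mem_of_realize_mem _⟩
  | imp φ ψ ih₁ ih₂ =>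
    intro M N _ _ _ _ _ _ _ _ hM hN α _ a b h s
    exact imp_congr (ih₁ hM hN h s) (ih₂ hM hN h s)
  | @all n φ ih =>
    have key : ∀ {M N : Type (max u v w)}
        [L.Structure M] [(withH L).Structure M] [(LHom.sumInl : L →ᴸ withH L).IsExpansionOn M]
        [L.Structure N] [(withH L).Structure N] [(LHom.sumInl : L →ᴸ withH L).IsExpansionOn N]
        [Nonempty M] [Nonempty N] (_ : M ⊨ indepTheory (L.completeTheory R))
        (_ : N ⊨ indepTheory (L.completeTheory R))
        {α : Type} [Finite α] {a : α → M} {b : α → N}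
        (_ : Similar L (predSet L M) (predSet L N) a b) (s : Fin n → α),
        φ.all.Realize default (b ∘ s) → φ.all.Realize default (a ∘ s) := by
      intro M N _ _ _ _ _ _ _ _ hM hN α _ a b h s hφ c
      have := ((models_indepTheory_iff hg).1 hM).1
      obtain ⟨N', _, _, _, j, α', _, e, a', b', h', rfl, hb', i, rfl⟩ := h.forth hg hN c
      have hN' : N' ⊨ indepTheory (L.completeTheory R) := (j.theory_model_iff _).1 hN
      have : Nonempty N' := Nonempty.map j inferInstance
      have h1 := (j.map_boundedFormula φ.all default (b ∘ s)).2 hφ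
      have h2 := h1 (b' i)
      have h3 : (Fin.snoc (j ∘ b ∘ s) (b' i) : Fin (n + 1) → N') =
          b' ∘ (Fin.snoc (e ∘ s) i : Fin (n + 1) → α') := by
        rw [Fin.comp_snoc, ← Function.comp_assoc, ← Function.comp_assoc, hb']
      have h4 : (Fin.snoc ((a' ∘ e) ∘ s) (a' i) : Fin (n + 1) → M) =
          a' ∘ (Fin.snoc (e ∘ s) i : Fin (n + 1) → α') := by
        rw [Fin.comp_snoc, ← Function.comp_assoc]
      rw [h4, ih hM hN' h', ← h3]
      rwa [Subsingleton.elim (default : Empty → N') (j ∘ default)]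
    intro M N _ _ _ _ _ _ _ _ hM hN α _ a b h s
    exact ⟨key hN hM h.symm s, key hM hN h s⟩

/-- The theory of H-structures of the theory of a geometric structure is complete. -/
theorem elementarilyEquivalent_of_models (hg : IsGeometric L R) {M N : Type w} [L.Structure M]
    [(withH L).Structure M] [(LHom.sumInl : L →ᴸ withH L).IsExpansionOn M] [L.Structure N]
    [(withH L).Structure N] [(LHom.sumInl : L →ᴸ withH L).IsExpansionOn N] [Nonempty M]
    [Nonempty N] (hM : M ⊨ indepTheory (L.completeTheory R))
    (hN : N ⊨ indepTheory (L.completeTheory R)) :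
    (withH L).ElementarilyEquivalent M N := by
  -- An extension realizing no conditions serves only to move the model into the universe where the
  -- back-and-forth stays.
  obtain ⟨M', _, j, -, -⟩ := exists_elementaryExtension (L := withH L) M (Empty.elim : Empty → M)
    (κ := PEmpty.{max u v + 1}) (fun i => i.elim) fun s => ⟨Classical.arbitrary M, fun i => i.elim⟩
  obtain ⟨N', _, j', -, -⟩ := exists_elementaryExtension (L := withH L) N (Empty.elim : Empty → N)
    (κ := PEmpty.{max u v + 1}) (fun i => i.elim) fun s => ⟨Classical.arbitrary N, fun i => i.elim⟩
  let _ : L.Structure M' := (LHom.sumInl : L →ᴸ withH L).reduct M'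
  let _ : L.Structure N' := (LHom.sumInl : L →ᴸ withH L).reduct N'
  have hM' : M' ⊨ indepTheory (L.completeTheory R) := (j.theory_model_iff _).1 hM
  have hN' : N' ⊨ indepTheory (L.completeTheory R) := (j'.theory_model_iff _).1 hN
  have : Nonempty M' := Nonempty.map j inferInstance
  have : Nonempty N' := Nonempty.map j' inferInstance
  obtain ⟨_, hHM⟩ := (models_indepTheory_iff hg).1 hM'
  obtain ⟨_, hHN⟩ := (models_indepTheory_iff hg).1 hN'
  have hsim : Similar L (predSet L M') (predSet L N') (Empty.elim : Empty → M')
      (Empty.elim : Empty → N') := by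
    refine ⟨fun φ => ?_, fun i => i.elim, fun h hh _ => ?_, fun h hh _ => ?_⟩
    · have h1 := realize_iff_of_model_completeTheory R M' φ
      have h2 := realize_iff_of_model_completeTheory R N' φ
      rw [Sentence.Realize] at h1 h2
      rw [Subsingleton.elim (Empty.elim : Empty → M') default,
        Subsingleton.elim (Empty.elim : Empty → N') default, h1, h2]
    · rw [Set.range_eq_empty, Set.empty_union]
      exact hHM.indep h hh
    · rw [Set.range_eq_empty, Set.empty_union]
      exact hHN.indep h hh
  refine elementarilyEquivalent_iff.2 fun φ => ?_
  rw [j.map_sentence, j'.map_sentence, Sentence.Realize, Sentence.Realize, Formula.Realize,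
    Formula.Realize]
  have := hsim.realize_boundedFormula_iff hg φ hM' hN' Fin.elim0
  rwa [Subsingleton.elim ((Empty.elim : Empty → M') ∘ Fin.elim0) default,
    Subsingleton.elim ((Empty.elim : Empty → N') ∘ Fin.elim0) default] at this

end Completeness

/-! ### Bases -/

section Basis

variable {L : FirstOrder.Language.{u, v}} {R : Type w'} [L.Structure R] {M : Type w}
  [L.Structure M]

/-- No element of the set is algebraic over the others. -/
def AclIndependent (L : FirstOrder.Language.{u, v}) {M : Type w} [L.Structure M]
    (S : Set M) : Prop :=
  ∀ h ∈ S, h ∉ acl L (S \ {h})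

/-- Zorn's lemma applies by finite character of `acl`. By exchange, adjoining an element outside the
closure keeps independence, so a maximal set spans. -/
theorem AclIndependent.exists_basis (hg : IsGeometric L R) [M ⊨ L.completeTheory R] {H : Set M}
    (hH : AclIndependent L H) :
    ∃ B : Set M, H ⊆ B ∧ AclIndependent L B ∧ acl L B = Set.univ := by
  obtain ⟨B, hHB, hB⟩ := zorn_subset_nonempty {S : Set M | AclIndependent L S} (by
    intro c hc hchain hne
    refine ⟨⋃₀ c, fun h hh hacl => ?_, fun s hs => Set.subset_sUnion_of_mem hs⟩
    obtain ⟨A, hA, hAfin, hhA⟩ := acl_finite_character hacl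
    obtain ⟨S, hS, hAS⟩ := DirectedOn.exists_mem_subset_of_finite_of_subset_sUnion hne
      hchain.directedOn (hAfin.insert h)
      (Set.insert_subset hh (hA.trans Set.sdiff_subset))
    refine hc hS h (hAS (Set.mem_insert _ _)) (acl_mono (fun x hx => ?_) hhA)
    exact ⟨hAS (Set.mem_insert_of_mem _ hx), (hA hx).2⟩) H hH
  refine ⟨B, hHB, hB.prop, Set.eq_univ_of_forall fun c => ?_⟩
  by_contra hc
  refine hc (subset_acl _ (hB.le_of_ge (y := insert c B) ?_ (Set.subset_insert c B)
    (Set.mem_insert c B)))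
  rintro h (rfl | hh) hacl
  · exact hc (acl_mono (fun x hx => hx.1.resolve_left hx.2) hacl)
  · have hcB : c ∉ B := fun h => hc (subset_acl _ h)
    have hsub : insert c B \ {h} ⊆ insert c (B \ {h}) := fun x hx =>
      hx.1.imp id fun hxB => ⟨hxB, hx.2⟩
    have := hg.acl_exchange (acl_mono hsub hacl) (hB.prop h hh)
    refine hc (acl_mono (Set.insert_subset hh Set.sdiff_subset) this)

theorem exists_mem_sol_notMem {H : Set M}
    (hdens : ∀ {α : Type} [Finite α] (φ : L.Formula (α ⊕ Fin 1)) (a : α → M),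
      (sol φ a).Infinite → ∃ h ∈ H, h ∈ sol φ a) {α : Type} [Finite α]
    {φ : L.Formula (α ⊕ Fin 1)} {a : α → M} (hinf : (sol φ a).Infinite) (F : Finset M) :
    ∃ h ∈ H, h ∈ sol φ a ∧ h ∉ F := by
  let χ : L.Formula ((α ⊕ Fin F.card) ⊕ Fin 1) :=
    φ.relabel (Sum.map Sum.inl id) ⊓
      Formula.iInf fun i : Fin F.card =>
        ∼(Term.equal (Term.var (Sum.inr 0)) (Term.var (Sum.inl (Sum.inr i))))
  have hχ : ∀ x, x ∈ sol χ (Sum.elim a fun i => (F.equivFin.symm i : M)) ↔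
      x ∈ sol φ a ∧ x ∉ F := by
    intro x
    rw [mem_sol, Formula.realize_inf, ← mem_sol, sol_relabel, Sum.elim_comp_inl,
      Formula.realize_iInf]
    refine and_congr_right fun _ => ?_
    simp only [Formula.realize_not, Formula.realize_equal, Term.realize_var, Sum.elim_inl,
      Sum.elim_inr]
    refine ⟨fun h hx => h (F.equivFin ⟨x, hx⟩) (by simp), fun h i e => h (e ▸ ?_)⟩
    exact (F.equivFin.symm i).2
  obtain ⟨h, hH, hh⟩ := hdens χ (Sum.elim a fun i => (F.equivFin.symm i : M)) (by
    refine (hinf.sdiff F.finite_toSet).mono fun x hx => (hχ x).2 ⟨hx.1, hx.2⟩)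
  exact ⟨h, hH, (hχ h).1 hh⟩

end Basis

/-! ### Expansions of the additive group of reals -/

section Group

variable {L : FirstOrder.Language.{u, v}} (ι : oaddLang →ᴸ L) {M : Type w} [L.Structure M]

/-- Addition in a model of the theory of the reals. -/
def addIn (x y : M) : M := Structure.funMap (addSym ι) ![x, y]

theorem realize_addSym {α : Type} (s t : L.Term α) (v : α → M) :
    ((addSym ι).apply₂ s t).realize v = addIn ι (s.realize v) (t.realize v) :=
  Term.realize_functions_apply₂

theorem addIn_mem_acl (x y : M) : addIn ι x y ∈ acl L {x, y} := by
  refine ⟨Fin 2, inferInstance, Term.equal (Term.var (Sum.inr 0))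
    ((addSym ι).apply₂ (Term.var (Sum.inl 0)) (Term.var (Sum.inl 1))), ![x, y], ?_, ?_,
    (Set.finite_singleton (addIn ι x y)).subset fun z hz => ?_⟩
  · intro i; fin_cases i <;> simp
  · simp [mem_sol, addIn]
  · simpa [mem_sol, addIn] using hz

/-- The formula `φ(a, s + x)` in the variables `(a, s)` and `x`. -/
def translate {α : Type} (φ : L.Formula (α ⊕ Fin 1)) : L.Formula ((α ⊕ Fin 1) ⊕ Fin 1) :=
  φ.subst (Sum.elim (fun i => Term.var (Sum.inl (Sum.inl i)))
    fun _ => (addSym ι).apply₂ (Term.var (Sum.inl (Sum.inr 0))) (Term.var (Sum.inr 0)))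

theorem mem_sol_translate {α : Type} {φ : L.Formula (α ⊕ Fin 1)} {a : α → M} {s x : M} :
    x ∈ sol (translate ι φ) (Sum.elim a fun _ => s) ↔ addIn ι s x ∈ sol φ a := by
  rw [mem_sol, translate, Formula.Realize, BoundedFormula.realize_subst]
  refine iff_of_eq ?_
  rw [mem_sol, Formula.Realize]
  congr 1
  funext i
  rcases i with i | i
  · rfl
  · exact realize_addSym ι _ _ _

variable [L.Structure ℝ] [ι.IsExpansionOn ℝ]

theorem addIn_real (x y : ℝ) : addIn ι x y = x + y := funMap_addSym ι x y

variable [M ⊨ L.completeTheory ℝ]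

theorem addIn_left_cancel {x y z : M} (h : addIn ι x y = addIn ι x z) : y = z := by
  have := transfer (R := ℝ) (M := M)
    (φ := (Term.equal ((addSym ι).apply₂ (Term.var (0 : Fin 3)) (Term.var 1))
      ((addSym ι).apply₂ (Term.var 0) (Term.var 2))).imp (Term.equal (Term.var 1) (Term.var 2)))
    (fun v => by simp [funMap_addSym]) ![x, y, z]
  simp only [Formula.realize_imp, Formula.realize_equal, realize_addSym, Term.realize_var] at this
  exact this h

theorem addIn_right_cancel {x y z : M} (h : addIn ι x z = addIn ι y z) : x = y := by
  have := transfer (R := ℝ) (M := M)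
    (φ := (Term.equal ((addSym ι).apply₂ (Term.var (0 : Fin 3)) (Term.var 2))
      ((addSym ι).apply₂ (Term.var 1) (Term.var 2))).imp (Term.equal (Term.var 0) (Term.var 1)))
    (fun v => by simp [funMap_addSym]) ![x, y, z]
  simp only [Formula.realize_imp, Formula.realize_equal, realize_addSym, Term.realize_var] at this
  exact this h

theorem exists_addIn_eq (x z : M) : ∃ y, addIn ι x y = z := by
  have := transfer (R := ℝ) (M := M)
    (φ := Formula.iExs (Fin 1) (Term.equal ((addSym ι).apply₂ (Term.var (Sum.inl (0 : Fin 2)))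
      (Term.var (Sum.inr (0 : Fin 1)))) (Term.var (Sum.inl 1))))
    (fun v => by
      simp only [Formula.realize_iExs, Formula.realize_equal, realize_addSym, Term.realize_var,
        Sum.elim_inl, Sum.elim_inr, addIn_real]
      exact ⟨fun _ => v 1 - v 0, by ring⟩) ![x, z]
  simp only [Formula.realize_iExs, Formula.realize_equal, realize_addSym, Term.realize_var,
        Sum.elim_inl, Sum.elim_inr] at this
  obtain ⟨y, hy⟩ := this
  exact ⟨y 0, hy⟩

theorem right_mem_acl_addIn (x y : M) : y ∈ acl L {x, addIn ι x y} := by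
  refine ⟨Fin 2, inferInstance, Term.equal (Term.var (Sum.inl 1))
    ((addSym ι).apply₂ (Term.var (Sum.inl 0)) (Term.var (Sum.inr 0))), ![x, addIn ι x y], ?_, ?_,
    (Set.finite_singleton y).subset fun z hz => ?_⟩
  · intro i; fin_cases i <;> simp
  · simp [mem_sol, addIn]
  · have : addIn ι x y = addIn ι x z := by simpa [mem_sol, addIn] using hz
    exact (addIn_left_cancel ι this).symm

theorem left_mem_acl_addIn (x y : M) : x ∈ acl L {y, addIn ι x y} := by
  refine ⟨Fin 2, inferInstance, Term.equal (Term.var (Sum.inl 1))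
    ((addSym ι).apply₂ (Term.var (Sum.inr 0)) (Term.var (Sum.inl 0))), ![y, addIn ι x y], ?_, ?_,
    (Set.finite_singleton x).subset fun z hz => ?_⟩
  · intro i; fin_cases i <;> simp
  · simp [mem_sol, addIn]
  · have : addIn ι x y = addIn ι z y := by simpa [mem_sol, addIn] using hz
    exact (addIn_right_cancel ι this).symm

theorem infinite_sol_translate {α : Type} {φ : L.Formula (α ⊕ Fin 1)} {a : α → M} (s : M)
    (h : (sol φ a).Infinite) : (sol (translate ι φ) (Sum.elim a fun _ => s)).Infinite := by
  have : sol (translate ι φ) (Sum.elim a fun _ => s) = addIn ι s ⁻¹' sol φ a :=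
    Set.ext fun x => mem_sol_translate ι
  rw [this]
  refine h.preimage fun z _ => ?_
  exact exists_addIn_eq ι s z

end Group

/-! ### Sums of many elements of a dense set -/

section Group

variable {L : FirstOrder.Language.{u, v}} [L.Structure ℝ] {M : Type w} [L.Structure M]
  [M ⊨ L.completeTheory ℝ]

/-- Elements with large support over a dense set exist in every infinite definable set. -/
theorem exists_mem_sol_large_support (ι : oaddLang →ᴸ L) [ι.IsExpansionOn ℝ] {H : Set M}
    (hdens : ∀ {α : Type} [Finite α] (φ : L.Formula (α ⊕ Fin 1)) (a : α → M),
      (sol φ a).Infinite → ∃ h ∈ H, h ∈ sol φ a) (n : ℕ) :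
    ∀ {α : Type} [Finite α] (φ : L.Formula (α ⊕ Fin 1)) (a : α → M), (sol φ a).Infinite →
      ∃ x ∈ sol φ a, ∃ F : Finset M, (F : Set M) ⊆ H ∧ F.card = n + 1 ∧ x ∈ acl L (F : Set M) ∧
        ∀ f ∈ F, f ∈ acl L (insert x ((F : Set M) \ {f})) := by
  classical
  induction n with
  | zero =>
    intro α _ φ a hinf
    obtain ⟨h, hH, hh⟩ := hdens φ a hinf
    refine ⟨h, hh, {h}, by simpa using hH, by simp, subset_acl _ (by simp), fun f hf => ?_⟩
    rw [Finset.mem_singleton.1 hf]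
    exact subset_acl _ (Set.mem_insert _ _)
  | succ n ih =>
    intro α _ φ a hinf
    -- Where `x₀` lies is irrelevant: `h` is then chosen in `H \ F` so that `x₀ + h` satisfies `φ`,
    -- and cancellation recovers each of `x₀`, `h` from the other and the sum.
    obtain ⟨x₀, -, F, hFH, hF, hx₀, hFx⟩ := ih φ a hinf
    obtain ⟨h, hH, hh, hhF⟩ := exists_mem_sol_notMem hdens
      (infinite_sol_translate ι x₀ hinf) F
    rw [mem_sol_translate] at hh
    refine ⟨addIn ι x₀ h, hh, insert h F, ?_, ?_, ?_, ?_⟩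
    · rw [Finset.coe_insert]; exact Set.insert_subset hH hFH
    · rw [Finset.card_insert_of_notMem hhF, hF]
    · rw [Finset.coe_insert]
      refine acl_subset_of_subset_acl ?_ (addIn_mem_acl ι x₀ h)
      refine Set.insert_subset (acl_mono (Set.subset_insert _ _) hx₀)
        (Set.singleton_subset_iff.2 (subset_acl _ (Set.mem_insert _ _)))
    · intro f hf
      rw [Finset.coe_insert]
      rcases Finset.mem_insert.1 hf with rfl | hfF
      · have hsub : (F : Set M) ⊆ insert f (F : Set M) \ {f} := fun z hz =>
          ⟨Or.inr hz, fun e => hhF ((Set.mem_singleton_iff.1 e) ▸ hz)⟩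
        refine acl_subset_of_subset_acl ?_ (right_mem_acl_addIn ι x₀ f)
        refine Set.insert_subset (acl_mono (hsub.trans (Set.subset_insert _ _)) hx₀)
          (Set.singleton_subset_iff.2 (subset_acl _ (Set.mem_insert _ _)))
      · refine acl_subset_of_subset_acl (Set.insert_subset ?_ ?_) (hFx f hfF)
        · refine acl_mono ?_ (left_mem_acl_addIn ι x₀ h)
          refine Set.insert_subset (Or.inr ⟨Or.inl rfl, fun e => hhF ?_⟩)
            (Set.singleton_subset_iff.2 (Or.inl rfl))
          rw [Set.mem_singleton_iff.1 e]; exact hfF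
        · refine Set.Subset.trans ?_ (subset_acl _)
          exact fun z hz => Or.inr ⟨Or.inr hz.1, hz.2⟩

/-- Bases that meet all infinite definable sets satisfy the extension property. -/
theorem AclIndependent.isHSet (ι : oaddLang →ᴸ L) [ι.IsExpansionOn ℝ] {H : Set M}
    (hind : AclIndependent L H)
    (hspan : acl L H = Set.univ)
    (hdens : ∀ {α : Type} [Finite α] (φ : L.Formula (α ⊕ Fin 1)) (a : α → M),
      (sol φ a).Infinite → ∃ h ∈ H, h ∈ sol φ a) : IsHSet L H := by
  classical
  refine ⟨hind, hdens, fun {α β} _ _ φ ψ a hinf hfin => ?_⟩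
  have hsupp : ∀ c : M, ∃ G : Set M, G ⊆ H ∧ G.Finite ∧ c ∈ acl L G := fun c =>
    acl_finite_character (hspan ▸ Set.mem_univ c : c ∈ acl L H)
  choose G hGH hGfin hG using hsupp
  have hfinU : (⋃ i, G (a i)).Finite := Set.finite_iUnion fun i => hGfin _
  -- The support `F` has one element more than the supports of the `a i` and the tuple `y` can have
  -- together.
  obtain ⟨x, hx, F, hFH, hF, -, hFx⟩ := exists_mem_sol_large_support ι hdens
    ((⋃ i, G (a i)).ncard + Nat.card β) φ a hinf
  refine ⟨x, hx, fun y hy hxy => ?_⟩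
  set S : Set M := (⋃ i, G (a i)) ∪ Set.range y with hS
  have hSH : S ⊆ H := Set.union_subset (Set.iUnion_subset fun i => hGH _)
    (Set.range_subset_iff.2 hy)
  have hxS : x ∈ acl L S := by
    refine acl_subset_of_subset_acl (B := Set.range (Sum.elim a y)) ?_
      ⟨_, inferInstance, ψ, Sum.elim a y, fun i => ⟨i, rfl⟩, hxy, hfin y⟩
    rintro _ ⟨i | i, rfl⟩
    · exact acl_mono ((Set.subset_iUnion (fun i => G (a i)) i).trans Set.subset_union_left) (hG _)
    · exact subset_acl _ (Or.inr ⟨i, rfl⟩)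
  -- If `x` is algebraic over `S`, a summand outside `S` would be algebraic over the rest of `H`. So
  -- `F ⊆ S`, which the cardinalities forbid.
  have hFS : (F : Set M) ⊆ S := by
    intro f hf
    by_contra hfS
    refine hind f (hFH hf) (acl_subset_of_subset_acl (Set.insert_subset ?_ ?_) (hFx f hf))
    · have hsub : S ⊆ H \ {f} := fun z hz =>
        ⟨hSH hz, fun e => hfS ((Set.mem_singleton_iff.1 e) ▸ hz)⟩
      exact acl_mono hsub hxS
    · exact (Set.sdiff_subset_sdiff_left hFH).trans (subset_acl _)
  have h1 : (F : Set M).ncard ≤ S.ncard :=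
    Set.ncard_le_ncard hFS (hfinU.union (Set.finite_range y))
  have h2 : S.ncard ≤ (⋃ i, G (a i)).ncard + (Set.range y).ncard := Set.ncard_union_le _ _
  have h3 : (Set.range y).ncard ≤ Nat.card β := by
    rw [← Set.image_univ, ← Set.ncard_univ]
    exact Set.ncard_image_le (Set.toFinite _)
  rw [Set.ncard_coe_finset] at h1
  omega

end Group

/-! ### Saturated H-structures -/

section Saturated

variable {L : FirstOrder.Language.{u, v}} {R : Type w'} [L.Structure R] {M : Type w}
  [L.Structure M] [(withH L).Structure M] [(LHom.sumInl : L →ᴸ withH L).IsExpansionOn M]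

/-- Being outside the closure of the predicate is a type without parameters, finitely satisfiable by
the extension axioms; saturation over the empty set realizes it. -/
theorem IsSaturated.acl_predSet_ne_univ (hg : IsGeometric L R) [M ⊨ L.completeTheory R]
    [Infinite M] (hH : IsHSet L (predSet L M)) (hsat : IsSaturated (withH L) M) :
    acl L (predSet L M) ≠ Set.univ := by
  classical
  let g : (Σ m : ℕ, L.Formula ((Empty ⊕ Fin m) ⊕ Fin 1)) →
      (withH L)[[(∅ : Set M)]].Formula (Fin 1) := fun p =>
    ((withH L).lhomWithConstants _).onFormula
      ((algOverH hg p.2).not.relabel (Sum.elim Empty.elim id))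
  have hgr : ∀ p (c : M), (g p).Realize (fun _ => c) ↔
      c ∉ sol (algOverH hg p.2) (Empty.elim : Empty → M) := by
    intro p c
    rw [LHom.realize_onFormula, Formula.realize_relabel, Formula.realize_not, mem_sol]
    refine not_congr (iff_of_eq ?_)
    congr 1
    funext i
    rcases i with i | i
    · exact i.elim
    · rfl
  have hinf : (sol (⊤ : L.Formula (Empty ⊕ Fin 1)) (Empty.elim : Empty → M)).Infinite := by
    refine Set.infinite_univ.mono fun x _ => ?_
    rw [mem_sol]
    simp
  obtain ⟨c, hc⟩ := hsat ∅ (by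
      rw [Cardinal.mk_eq_zero]
      exact Cardinal.mk_ne_zero M |>.bot_lt)
    (Set.range g) (by
      intro p₀ hp₀
      choose f hf using fun φ : p₀ => hp₀ φ.2
      obtain ⟨c, -, hc⟩ := exists_mem_sol_forall_notMem hg hH hinf (Finset.univ.image f)
      refine ⟨c, fun φ hφ => ?_⟩
      have := (hgr (f ⟨φ, hφ⟩) c).2 (hc _ (Finset.mem_image_of_mem _ (Finset.mem_univ _)))
      rwa [hf] at this)
  intro huniv
  have h1 : c ∈ acl L (Set.range (Empty.elim : Empty → M) ∪ predSet L M) := by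
    rw [Set.range_eq_empty, Set.empty_union, huniv]
    trivial
  obtain ⟨m, ψ, hψ⟩ := (mem_acl_union_predSet_iff hg).1 h1
  exact (hgr ⟨m, ψ⟩ c).1 (hc _ ⟨_, rfl⟩) hψ

end Saturated

theorem infinite_of_model_completeTheory {L : FirstOrder.Language.{u, v}} {R : Type w'}
    [L.Structure R] [Infinite R] {M : Type w} [L.Structure M] [M ⊨ L.completeTheory R] :
    Infinite M := by
  have hR : (sol (⊤ : L.Formula (Empty ⊕ Fin 1)) (Empty.elim : Empty → R)).Infinite := by
    refine Set.infinite_univ.mono fun x _ => ?_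
    rw [mem_sol]
    simp
  have hM : (sol (⊤ : L.Formula (Empty ⊕ Fin 1)) (Empty.elim : Empty → M)).Infinite := by
    refine infinite_sol_iff.2 fun k => transfer (R := R) (fun v => ?_) _
    rw [Subsingleton.elim v Empty.elim]
    exact infinite_sol_iff.1 hR k
  exact Set.infinite_univ_iff.1 (hM.mono (Set.subset_univ _))

/-- In a saturated H-structure of an o-minimal expansion of the ordered group of reals, the orbit of
the predicate differs from its elementary class. -/
theorem orbit_ne_elemClass {L : FirstOrder.Language.{u, v}} [L.Structure ℝ]
    (ι : oaddLang →ᴸ L) [ι.IsExpansionOn ℝ] (homin : IsOMinimal L ℝ)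
    (C : Type w) [L.Structure C] (H : Set C)
    (hC : IsMonsterModel (indepTheory (L.completeTheory ℝ)) (Expand C H)) :
    orbit L H ≠ elemClass L H := by
  obtain ⟨hmod, hsat⟩ := hC
  have hg := homin.isGeometric ι
  have hT' : Expand C H ⊨ L.completeTheory ℝ :=
    (LHom.onTheory_model (LHom.sumInl : L →ᴸ withH L) _).1
      ⟨fun σ hσ => hmod.realize_of_mem σ (Or.inl (Or.inl (Or.inl hσ)))⟩
  have hT : C ⊨ L.completeTheory ℝ := hT'
  have hinf : Infinite C := infinite_of_model_completeTheory (L := L) (R := ℝ)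
  have hinf' : Infinite (Expand C H) := hinf
  have hH' : IsHSet L (predSet L (Expand C H)) := ((models_indepTheory_iff hg).1 hmod).2
  have hH : IsHSet L H := hH'
  obtain ⟨B, hHB, hBind, hB⟩ := AclIndependent.exists_basis (L := L) (M := C) (R := ℝ) hg hH.indep
  -- Density passes from `H` to the larger set `B`.
  have hBH : IsHSet L B := hBind.isHSet (M := C) ι hB fun φ a hinf =>
    let ⟨h, h1, h2⟩ := hH.dens φ a hinf
    ⟨h, hHB h1, h2⟩
  have hTB : Expand C B ⊨ L.completeTheory ℝ := hT
  have hne : Nonempty (Expand C B) := inferInstanceAs (Nonempty C)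
  have hBmod : Expand C B ⊨ indepTheory (L.completeTheory ℝ) :=
    (models_indepTheory_iff hg).2 ⟨hTB, hBH⟩
  have hBe : B ∈ elemClass L H := elementarilyEquivalent_of_models hg hmod hBmod
  intro heq
  rw [← heq] at hBe
  obtain ⟨f, hf⟩ := hBe
  exact hsat.acl_predSet_ne_univ hg hH' (acl_eq_univ_of_image f hf hB)

end HStr

theorem corollary4p2 {L : FirstOrder.Language.{u, v}} [L.Structure ℝ]
    (ι : HStr.oaddLang →ᴸ L) [ι.IsExpansionOn ℝ] (homin : HStr.IsOMinimal L ℝ)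
    (C : Type w) [L.Structure C] (H : Set C)
    (hC : HStr.IsMonsterModel (HStr.indepTheory (L.completeTheory ℝ)) (HStr.Expand C H)) :
    HStr.orbit L H ≠ HStr.elemClass L H :=
  HStr.orbit_ne_elemClass ι homin C H hC
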